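/- **Theorem.** All graphs are finite and simple. For a graph $G$ and vertices $x,y$ of $G$ (adjacent or not), let $G[x\to y]$ be the graph obtained from $G$ by replacing, for every $w\in N_G(x)\setminus N_G[y]$, the edge $wx$ by the edge $wy$ (Kelmans operation). Call a real-valued function $\mathcal P$ on finite graphs *feasible* if for every connected graph $G$ (I) $\mathcal P(G)\le \mathcal P(G[x\to y])$ for all vertices $x,y$ of $G$; (II) $\mathcal P(G)<\mathcal P(G+e)$ for every new edge $e\notin E(G)$ with at least one end in $V(G)$, where the other end of $e$ is either another vertex of $G$ or a new vertex, which is then added to $G$. Let $n\ge k\ge 5$ be integers, let $t=\lfloor (k-1)/2\rfloor$, and let $\mathcal P$ be feasible. Suppose that $G$ is a 2-connected graph on $n$ vertices without cycles of length at least $k$, and that $\mathcal P(G)\ge\mathcal P(G')$ for every 2-connected graph $G'$ on the same vertex set without cycles of length at least $k$. Then, for some integer $s$ with $2\le s\le t$, $G$ is isomorphic to $$W_{n,k,s}=K_s\vee\bigl((n-k+s)K_1\cup K_{k-2s}\bigr),$$ where $\cup$ is the disjoint union, $mK_1$ is the graph with $m$ vertices and no edges, and $\vee$ is the join (the disjoint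 union together with all edges between the two parts). -/

import Mathlib

namespace KelmansExtremal

universe u v

/-- The join `G ∨ H`: the disjoint union of `G` and `H` together with all edges between them. -/
def join {V : Type u} {W : Type v} (G : SimpleGraph V) (H : SimpleGraph W) :
    SimpleGraph (V ⊕ W) :=
  (G ⊕g H) ⊔ completeBipartiteGraph V W

/-- `W_{n,k,s} = K_s ∨ ((n-k+s) K_1 ∪ K_{k-2s})`; meant for `n ≥ k` and `2 * s ≤ k`, so that the
subtractions of natural numbers are the ordinary ones. -/
def graphW (n k s : ℕ) : SimpleGraph (Fin s ⊕ (Fin (n - k + s) ⊕ Fin (k - 2 * s))) :=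
  join (⊤ : SimpleGraph (Fin s))
    ((⊥ : SimpleGraph (Fin (n - k + s))) ⊕g (⊤ : SimpleGraph (Fin (k - 2 * s))))

/-- The graph `G[x → y]` after a Kelmans operation from `x` to `y` (`x` and `y` may be adjacent or
not): every edge `wx` with `w ∈ N(x) \ N[y]` is replaced by the edge `wy`. -/
def kelmans {V : Type u} (G : SimpleGraph V) (x y : V) : SimpleGraph V :=
  SimpleGraph.fromEdgeSet
    ((G.edgeSet \ {e | ∃ w ∈ G.neighborSet x \ insert y (G.neighborSet y), e = s(w, x)}) ∪
      {e | ∃ w ∈ G.neighborSet x \ insert y (G.neighborSet y), e = s(w, y)})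

/-- The graph obtained from `G` by adding a new vertex `none` and the single edge joining it to
the vertex `x` of `G`. -/
def addPendant {V : Type u} (G : SimpleGraph V) (x : V) : SimpleGraph (Option V) :=
  G.map Function.Embedding.some ⊔ SimpleGraph.edge (some x) none

/-- A graph parameter: a real-valued function on finite graphs. (Invariance under isomorphism is
not required; the invariant parameters are among these.) -/
abbrev GraphParameter : Type (u + 1) :=
  ∀ (V : Type u) [Finite V], SimpleGraph V → ℝ

/-- Feasibility of a graph parameter. -/
structure Feasible (P : GraphParameter.{u}) : Prop where
  /-- A Kelmans operation on a connected graph does not decrease the parameter. -/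
  le_kelmans : ∀ (V : Type u) [Finite V] (G : SimpleGraph V), G.Connected →
    ∀ x y : V, P V G ≤ P V (kelmans G x y)
  /-- Adding a new edge between two vertices of a connected graph increases the parameter. -/
  lt_addEdge : ∀ (V : Type u) [Finite V] (G : SimpleGraph V), G.Connected →
    ∀ x y : V, x ≠ y → ¬ G.Adj x y → P V G < P V (G ⊔ SimpleGraph.edge x y)
  /-- Adding a new edge from a vertex of a connected graph to a new vertex increases the
  parameter. -/
  lt_addPendant : ∀ (V : Type u) [Finite V] (G : SimpleGraph V), G.Connected →
    ∀ x : V, P V G < P (Option V) (addPendant G x)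

/-- `G` is 2-connected: it has at least three vertices, is connected, and stays connected when any
one vertex is deleted. -/
def TwoConnected {V : Type u} (G : SimpleGraph V) : Prop :=
  3 ≤ Nat.card V ∧ G.Connected ∧ ∀ x : V, (G.induce {x}ᶜ).Connected

/-- `G` contains no cycle of length at least `k`. -/
def LongCycleFree {V : Type u} (k : ℕ) (G : SimpleGraph V) : Prop :=
  ∀ (x : V) (c : G.Walk x x), c.IsCycle → c.length < k

end KelmansExtremal

/-! The value of `P` at the extremal graph `G` is squeezed between that of a supergraph and that of
a competitor isomorphic to `graphW`.

By (II), `G` is edge-maximal, so the ends of every nonadjacent pair are joined by a path on at least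
`k` vertices (`Saturated`). Kopylov's argument (`Saturated.exists_degenerate`, with `exists_rank`)
then yields some `s` with `2 ≤ s ≤ t` and an ordering in which every vertex from position `k - s` on
has at most `s` earlier neighbours. Its engine is Pósa's lemma `Unseparated.exists_isCycleList`: a
long path whose ends have degree sum at least `k` on it forces a cycle of length at least `k`. When
the chords at the two ends do not cross, that lemma needs two disjoint paths with one end prescribed
on each side, built by augmentation in `Partial.exists_linkage`.

Now add edges until the first `k - s` vertices form a clique and every later vertex has exactly `s`
earlier neighbours (`Built`). The new graph `G'` may contain long cycles, but Kelmans operations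
move all sets of earlier neighbours onto one set `S` without decreasing `P` (`Feasible.le_shifted`).
The result `shifted` is 2-connected without long cycles, so `P G ≤ P G' ≤ P (shifted ..) ≤ P G`. Had
an edge been added, the first inequality would be strict; hence `G = G'`.

So `G` itself is `Built`, and it has no long cycles. `Built.exists_eq_shifted` shows that these two
properties force `G` to be `shifted` for some `S`, by an Ore-type closure argument on sets of `k`
vertices (`exists_common_neighbors`). -/

namespace KelmansExtremal

universe u

/-! ### Paths and cycles as vertex lists -/

/-- A list of distinct vertices in which consecutive vertices are adjacent. -/
structure IsPathList {V : Type u} (G : SimpleGraph V) (l : List V) : Prop where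
  chain : l.IsChain G.Adj
  nodup : l.Nodup

/-- A list of at least three distinct vertices in which cyclically consecutive vertices are
adjacent. -/
structure IsCycleList {V : Type u} (G : SimpleGraph V) (l : List V) : Prop where
  three_le : 3 ≤ l.length
  nodup : l.Nodup
  chain : l.IsChain G.Adj
  closes : ∀ x ∈ l.getLast?, ∀ y ∈ l.head?, G.Adj x y

section Lists

variable {V : Type u} {G : SimpleGraph V}

theorem isChain_adj_reverse {l : List V} : l.reverse.IsChain G.Adj ↔ l.IsChain G.Adj := by
  rw [List.isChain_reverse]
  exact ⟨fun h => h.imp fun _ _ h => h.symm, fun h => h.imp fun _ _ h => h.symm⟩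

theorem IsPathList.reverse {l : List V} (h : IsPathList G l) : IsPathList G l.reverse :=
  ⟨isChain_adj_reverse.2 h.chain, List.nodup_reverse.2 h.nodup⟩

theorem IsCycleList.append_comm {l m : List V} (h : IsCycleList G (l ++ m)) :
    IsCycleList G (m ++ l) := by
  rcases eq_or_ne l [] with rfl | hl
  · simpa using h
  rcases eq_or_ne m [] with rfl | hm
  · simpa using h
  obtain ⟨h1, h2, h3, h4⟩ := h
  rw [List.isChain_append] at h3
  refine ⟨by simp at h1 ⊢; omega, List.nodup_append_comm.1 h2, ?_, ?_⟩
  · rw [List.isChain_append]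
    refine ⟨h3.2.1, h3.1, fun x hx y hy => h4 x ?_ y ?_⟩
    · rw [List.getLast?_append_of_ne_nil _ hm]; exact hx
    · rw [List.head?_append_of_ne_nil _ hl]; exact hy
  · intro x hx y hy
    rw [List.getLast?_append_of_ne_nil _ hl] at hx
    rw [List.head?_append_of_ne_nil _ hm] at hy
    exact h3.2.2 x hx y hy

theorem IsCycleList.length_lt {k : ℕ} (hG : LongCycleFree k G) {l : List V}
    (h : IsCycleList G l) : l.length < k := by
  obtain ⟨h1, h2, h3, h4⟩ := h
  match l, h1 with
  | a :: b :: l, h1 =>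
    obtain ⟨c, hc⟩ : ∃ c, (b :: l).getLast? = some c := by
      exact ⟨_, List.getLast?_eq_some_getLast (by simp)⟩
    have hca : G.Adj c a := h4 c (by simpa using hc) a (by simp)
    have hab : G.Adj a b := (List.isChain_cons_cons.1 h3).1
    obtain ⟨p, hp⟩ : ∃ p : G.Walk b c, p.support = b :: l := by
      have hne : b :: l ≠ [] := by simp
      have hl : (b :: l).getLast hne = c := by
        have := List.getLast?_eq_some_getLast hne
        rw [hc] at this
        simpa using this.symm
      exact ⟨(SimpleGraph.Walk.ofSupport _ hne (List.isChain_cons_cons.1 h3).2).copy rfl hl,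
        (SimpleGraph.Walk.support_copy ..).trans (SimpleGraph.Walk.support_ofSupport ..)⟩
    have hpl : p.length = l.length := by
      have := p.length_support
      simp [hp] at this
      exact this.symm
    have hcyc : (SimpleGraph.Walk.cons hca (SimpleGraph.Walk.cons hab p)).IsCycle := by
      rw [SimpleGraph.Walk.cons_isCycle_iff, SimpleGraph.Walk.isPath_def]
      have ha : a ∉ p.support := by
        rw [hp]; exact (List.nodup_cons.1 h2).1
      refine ⟨by simpa [hp] using h2, fun he => ?_⟩
      rw [SimpleGraph.Walk.edges_cons, List.mem_cons] at he
      rcases he with he | he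
      · have hcb : c = b := by
          have := hca.ne
          aesop
        have : c ∈ l := by
          have hl : l ≠ [] := by rintro rfl; simp at h1
          obtain ⟨d, l', rfl⟩ := List.exists_cons_of_ne_nil hl
          rw [List.getLast?_cons_cons] at hc
          exact List.mem_of_getLast? hc
        simp [hcb] at this
        exact (List.nodup_cons.1 (List.nodup_cons.1 h2).2).1 this
      · exact ha (p.snd_mem_support_of_mem_edges he)
    have := hG _ _ hcyc
    simp only [SimpleGraph.Walk.length_cons, hpl] at this
    simpa using this

theorem LongCycleFree.of_isCycleList {k : ℕ} (h : ∀ l, IsCycleList G l → l.length < k) :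
    LongCycleFree k G := by
  intro x c hc
  have hlen := hc.three_le_length
  cases c with
  | nil => simp at hlen
  | cons hadj p =>
    rw [SimpleGraph.Walk.cons_isCycle_iff] at hc
    have hp : p.support.length = p.length + 1 := p.length_support
    have := h p.support ⟨by simp at hlen; omega, hc.1.support_nodup, p.isChain_adj_support, ?_⟩
    · simp; omega
    · intro a ha b hb
      rw [← p.cons_tail_support] at hb
      rw [List.getLast?_eq_some_getLast p.support_ne_nil] at ha
      simp only [List.head?_cons, Option.mem_def, Option.some.injEq, p.getLast_support] at ha hb
      subst ha hb
      exact hadj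

theorem exists_first_split (p : V → Prop) : ∀ l : List V, (∃ x ∈ l, p x) →
    ∃ l₁ a l₂, l = l₁ ++ a :: l₂ ∧ p a ∧ ∀ x ∈ l₁, ¬ p x
  | [], h => by simp at h
  | b :: l, h => by
    by_cases hb : p b
    · exact ⟨[], b, l, rfl, hb, by simp⟩
    · obtain ⟨l₁, a, l₂, rfl, h1, h2⟩ := exists_first_split p l (by simpa [hb] using h)
      exact ⟨b :: l₁, a, l₂, rfl, h1, by simpa [hb] using h2⟩

theorem exists_last_split (p : V → Prop) (l : List V) (h : ∃ x ∈ l, p x) :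
    ∃ l₁ a l₂, l = l₁ ++ a :: l₂ ∧ p a ∧ ∀ x ∈ l₂, ¬ p x := by
  obtain ⟨l₁, a, l₂, h1, h2, h3⟩ := exists_first_split p l.reverse (by simpa using h)
  refine ⟨l₂.reverse, a, l₁.reverse, ?_, h2, by simpa using h3⟩
  rw [← List.reverse_reverse l, h1]
  simp

/-- A cycle list after the addition of an edge `uv`: it is a cycle list of the original graph, or
the vertices can be arranged as a path from `u` to `v`. -/
theorem IsCycleList.of_sup_edge {u v : V} {l : List V}
    (h : IsCycleList (G ⊔ SimpleGraph.edge u v) l) :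
    IsCycleList G l ∨ ∃ q, IsPathList G (u :: (q ++ [v])) ∧ (u :: (q ++ [v])).Perm l := by
  classical
  by_cases hG : IsCycleList G l
  · exact Or.inl hG
  right
  -- Rotate the cycle so that a pair that is not an edge of `G` becomes the closing pair.
  have key : ∃ a m b, (a :: (m ++ [b])).Perm l ∧ IsCycleList (G ⊔ SimpleGraph.edge u v) (a :: (m ++ [b])) ∧
      ¬ G.Adj b a := by
    by_cases hc : l.IsChain G.Adj
    · have : ¬ ∀ x ∈ l.getLast?, ∀ y ∈ l.head?, G.Adj x y := fun h' =>
        hG ⟨h.three_le, h.nodup, hc, h'⟩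
      push Not at this
      obtain ⟨b, hb, a, ha, hab⟩ := this
      match l, h.three_le with
      | x :: y :: l, _ =>
        simp at ha; subst ha
        obtain ⟨m, hm⟩ := List.getLast?_eq_some_iff.1 (by simpa using hb : (y :: l).getLast? = some b)
        rw [hm] at h ⊢
        exact ⟨x, m, b, List.Perm.refl _, h, hab⟩
    · rw [List.isChain_iff_forall_rel_of_append_cons_cons] at hc
      push Not at hc
      obtain ⟨b, a, l₁, l₂, rfl, hab⟩ := hc
      refine ⟨a, l₂ ++ l₁, b, ?_, ?_, hab⟩
      · have : a :: (l₂ ++ l₁ ++ [b]) = (a :: l₂) ++ (l₁ ++ [b]) := by simp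
        rw [this]
        refine List.perm_append_comm.trans ?_
        simp
      · have := IsCycleList.append_comm (l := l₁ ++ [b]) (m := a :: l₂) (by simpa using h)
        simpa using this
  obtain ⟨a, m, b, hperm, hcyc, hab⟩ := key
  have hadj := hcyc.closes b (List.getLast?_concat (l := a :: m)) a (by simp)
  have hnd := hcyc.nodup
  have hpath : IsPathList G (a :: (m ++ [b])) := by
    refine ⟨?_, hnd⟩
    rw [List.isChain_iff_forall_rel_of_append_cons_cons]
    intro x y l₁ l₂ heq
    have hxy := List.isChain_iff_forall_rel_of_append_cons_cons.1 hcyc.chain heq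
    have h3 := hcyc.three_le
    -- This pair and the closing pair would both be `uv`, which cannot occur twice around a cycle on
    -- at least three distinct vertices.
    by_contra hne
    have hadj : G.Adj b a ∨ s(b, a) = s(u, v) := by
      rw [SimpleGraph.sup_adj, SimpleGraph.edge_adj] at hadj
      aesop
    have hxy' : s(x, y) = s(u, v) := by
      rw [SimpleGraph.sup_adj, SimpleGraph.edge_adj] at hxy
      aesop
    have h1 : s(x, y) = s(b, a) := by grind
    have hm : m ≠ [] := by rintro rfl; simp at h3
    simp only [Sym2.eq_iff] at h1
    rcases l₁ with - | ⟨z, l₁⟩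
    · obtain ⟨c, m, rfl⟩ := List.exists_cons_of_ne_nil hm
      simp at heq hnd
      grind
    · simp at heq
      rw [heq.2, heq.1] at hnd
      have : s(x, y) = s(b, z) := by simp [h1, ← heq.1]
      grind
  have : (b = u ∧ a = v) ∨ (b = v ∧ a = u) := by
    simp [hab, SimpleGraph.edge_adj] at hadj
    tauto
  rcases this with ⟨rfl, rfl⟩ | ⟨rfl, rfl⟩
  · refine ⟨m.reverse, ?_, ?_⟩
    · simpa using hpath.reverse
    · refine List.Perm.trans ?_ hperm
      have := (List.reverse_perm (a :: (m ++ [b])))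
      simpa using this
  · exact ⟨m, hpath, hperm⟩

/-- Exchanging the end of a path at a pair of chords. -/
theorem IsPathList.isCycleList_of_cross {α γ β : List V} (h : IsPathList G (α ++ (γ ++ β)))
    (hα : α ≠ []) (hβ : β ≠ [])
    (h1 : ∀ a ∈ α.getLast?, ∀ y ∈ β.getLast?, G.Adj a y)
    (h2 : ∀ b ∈ β.head?, ∀ x ∈ α.head?, G.Adj b x) (h3 : 3 ≤ α.length + β.length) :
    IsCycleList G (α ++ β.reverse) := by
  have hc := h.chain
  have hn := h.nodup
  rw [List.isChain_append, List.isChain_append] at hc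
  refine ⟨by simpa using h3, ?_, ?_, ?_⟩
  · simp only [List.nodup_append] at hn ⊢
    grind
  · rw [List.isChain_append, isChain_adj_reverse]
    refine ⟨hc.1, hc.2.1.2.1, ?_⟩
    simpa using h1
  · intro x hx y hy
    rw [List.getLast?_append_of_ne_nil _ (by simpa using hβ)] at hx
    rw [List.head?_append_of_ne_nil _ hα] at hy
    exact h2 x (by simpa using hx) y hy

end Lists

/-! ### Crossing chords of a path, and ears avoiding a vertex -/

section Posa

variable {V : Type u} {G : SimpleGraph V}

/-- A path whose ends have many neighbours on it, in crossing position, can be closed to a long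
cycle. -/
theorem IsPathList.exists_isCycleList_of_cross [DecidableEq V] {l : List V} (h : IsPathList G l)
    (hl : 3 ≤ l.length) {x y : V} (hx : l.head? = some x) (hy : l.getLast? = some y)
    (N₁ N₂ : Finset V) (h1 : ∀ v ∈ N₁, v ∈ l ∧ G.Adj x v) (h2 : ∀ v ∈ N₂, v ∈ l ∧ G.Adj v y)
    (h3 : 3 ≤ N₁.card + N₂.card)
    (hcross : l.length ≤ N₁.card + N₂.card ∨ ∃ a ∈ N₂, ∃ b ∈ N₁, l.idxOf a < l.idxOf b) :
    ∃ m, IsCycleList G m ∧ m ⊆ l ∧ (m.Perm l ∨ N₁.card + N₂.card ≤ m.length) := by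
  have hidx : ∀ v ∈ l, ∃ hv : l.idxOf v < l.length, l[l.idxOf v] = v := fun v hv =>
    ⟨List.idxOf_lt_length_iff.2 hv, List.getElem_idxOf _⟩
  have hinj : ∀ v ∈ l, ∀ w ∈ l, l.idxOf v = l.idxOf w → v = w := fun v hv w _ => by
    intro e; exact (List.idxOf_inj hv).1 e
  have hx0 : ∃ h0 : 0 < l.length, l[0] = x := by
    rw [List.head?_eq_getElem?, List.getElem?_eq_some_iff] at hx; exact hx
  have hyl : ∃ h0 : l.length - 1 < l.length, l[l.length - 1] = y := by
    rw [List.getLast?_eq_getElem?, List.getElem?_eq_some_iff] at hy; exact hy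
  have hpos1 : ∀ v ∈ N₁, 0 < l.idxOf v := fun v hv => by
    obtain ⟨h4, h5⟩ := h1 v hv
    obtain ⟨h6, h7⟩ := hidx v h4
    rcases Nat.eq_zero_or_pos (l.idxOf v) with h0 | h0
    · obtain ⟨h8, h9⟩ := hx0
      simp only [h0] at h7
      exact absurd (h9.symm.trans h7) h5.ne
    · exact h0
  have hlt2 : ∀ v ∈ N₂, l.idxOf v < l.length - 1 := fun v hv => by
    obtain ⟨h4, h5⟩ := h2 v hv
    obtain ⟨h6, h7⟩ := hidx v h4
    rcases Nat.lt_or_ge (l.idxOf v) (l.length - 1) with h0 | h0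
    · exact h0
    · obtain ⟨h8, h9⟩ := hyl
      have : l.idxOf v = l.length - 1 := by omega
      simp only [this] at h7
      exact absurd (h7.symm.trans h9) h5.ne
  -- A vertex of `N₁` is recorded by the position of its predecessor, so a common element of `I₁`
  -- and `I₂` is a crossing at two consecutive vertices of the path.
  set I₁ := N₁.image (fun v => l.idxOf v - 1) with hI₁
  set I₂ := N₂.image (fun v => l.idxOf v) with hI₂
  have hc1 : I₁.card = N₁.card := by
    apply Finset.card_image_of_injOn
    intro v hv w hw hvw
    have := hpos1 v hv
    have := hpos1 w hw
    exact hinj v (h1 v hv).1 w (h1 w hw).1 (by simp at hvw; omega)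
  have hc2 : I₂.card = N₂.card := by
    apply Finset.card_image_of_injOn
    intro v hv w hw hvw
    exact hinj v (h2 v hv).1 w (h2 w hw).1 hvw
  have hs1 : I₁ ⊆ Finset.range (l.length - 1) := by
    intro i hi
    obtain ⟨v, hv, rfl⟩ := Finset.mem_image.1 hi
    have := hpos1 v hv
    obtain ⟨h6, h7⟩ := hidx v (h1 v hv).1
    simp; omega
  have hs2 : I₂ ⊆ Finset.range (l.length - 1) := by
    intro i hi
    obtain ⟨v, hv, rfl⟩ := Finset.mem_image.1 hi
    have := hlt2 v hv
    simpa using this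
  have hex : ∃ d, ∃ a ∈ N₂, ∃ b ∈ N₁, l.idxOf a + 1 + d = l.idxOf b := by
    rcases hcross with hcard | ⟨a, ha, b, hb, hab⟩
    · have : ¬ Disjoint I₁ I₂ := by
        intro hd
        have := Finset.card_le_card (Finset.union_subset hs1 hs2)
        rw [Finset.card_union_of_disjoint hd, Finset.card_range] at this
        omega
      obtain ⟨i, hi1, hi2⟩ := Finset.not_disjoint_iff.1 this
      obtain ⟨v, hv, rfl⟩ := Finset.mem_image.1 hi1
      obtain ⟨w, hw, hvw⟩ := Finset.mem_image.1 hi2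
      have := hpos1 v hv
      exact ⟨0, w, hw, v, hv, by omega⟩
    · exact ⟨l.idxOf b - l.idxOf a - 1, a, ha, b, hb, by omega⟩
  classical
  -- Take a crossing with the fewest vertices, `d` of them, strictly between `a` and `b`. The cycle
  -- skips exactly these.
  obtain ⟨a, ha, b, hb, hab⟩ := Nat.find_spec hex
  have hmin : ∀ d, d < Nat.find hex → ¬ ∃ a ∈ N₂, ∃ b ∈ N₁, l.idxOf a + 1 + d = l.idxOf b :=
    fun d hd => Nat.find_min hex hd
  set d := Nat.find hex with hd
  obtain ⟨hja, hjb⟩ := hidx b (h1 b hb).1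
  obtain ⟨hia, hib⟩ := hidx a (h2 a ha).1
  have hsplit : l = l.take (l.idxOf a + 1) ++ ((l.drop (l.idxOf a + 1)).take d ++ l.drop (l.idxOf b)) := by
    conv_lhs => rw [← List.take_append_drop (l.idxOf a + 1) l, ← List.take_append_drop d (l.drop _)]
    rw [List.drop_drop, hab]
  have hlen : (l.take (l.idxOf a + 1)).length + (l.drop (l.idxOf b)).length + d = l.length := by
    simp; omega
  have hbig : 3 ≤ (l.take (l.idxOf a + 1)).length + (l.drop (l.idxOf b)).length ∧ (d = 0 ∨
      N₁.card + N₂.card ≤ (l.take (l.idxOf a + 1)).length + (l.drop (l.idxOf b)).length) := by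
    rcases Nat.eq_zero_or_pos d with h0 | h0
    · omega
    · have hdis : Disjoint I₁ I₂ := by
        rw [Finset.disjoint_left]
        intro i hi1 hi2
        obtain ⟨v, hv, rfl⟩ := Finset.mem_image.1 hi1
        obtain ⟨w, hw, hvw⟩ := Finset.mem_image.1 hi2
        have := hpos1 v hv
        exact hmin 0 h0 ⟨w, hw, v, hv, by omega⟩
      -- By minimality of `d` the gap contributes nothing to `I₁ ∪ I₂` apart from its outermost
      -- positions, those of `a` and of the predecessor of `b`. This clears `d - 1` of the `l.length
      -- - 1` positions, whence the bound `l.length - d`, the length of the cycle.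
      have hsub : I₁ ∪ I₂ ⊆ Finset.range (l.length - 1) \ Finset.Ico (l.idxOf a + 1) (l.idxOf b - 1) := by
        intro i hi
        rw [Finset.mem_sdiff]
        refine ⟨Finset.union_subset hs1 hs2 hi, ?_⟩
        rw [Finset.mem_Ico]
        rintro ⟨h5, h6⟩
        rcases Finset.mem_union.1 hi with hi | hi
        · obtain ⟨v, hv, rfl⟩ := Finset.mem_image.1 hi
          have := hpos1 v hv
          exact hmin (l.idxOf v - l.idxOf a - 1) (by omega) ⟨a, ha, v, hv, by omega⟩
        · obtain ⟨v, hv, rfl⟩ := Finset.mem_image.1 hi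
          exact hmin (l.idxOf b - l.idxOf v - 1) (by omega) ⟨v, hv, b, hb, by omega⟩
      have := Finset.card_le_card hsub
      rw [Finset.card_union_of_disjoint hdis, Finset.card_sdiff_of_subset, Finset.card_range, Nat.card_Ico] at this
      · omega
      · intro i hi
        simp at hi ⊢; omega
  have hpath := h
  rw [hsplit] at hpath
  refine ⟨_, hpath.isCycleList_of_cross ?_ ?_ ?_ ?_ hbig.1, ?_, ?_⟩
  · intro h0; simp at h0; simp [h0] at hl
  · intro h0; simp at h0; omega
  · intro u hu v hv
    rw [List.getLast?_drop, if_neg (by omega), hy] at hv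
    rw [List.getLast?_take, if_neg (by omega), Nat.add_sub_cancel, List.getElem?_eq_getElem hia,
      hib] at hu
    simp at hu hv
    subst hu hv
    exact (h2 a ha).2
  · intro u hu v hv
    rw [List.head?_drop, List.getElem?_eq_getElem hja, hjb] at hu
    rw [List.head?_take, if_neg (by omega), hx] at hv
    simp at hu hv
    subst hu hv
    exact (h1 b hb).2.symm
  · intro v hv
    rcases List.mem_append.1 hv with hv | hv
    · exact List.mem_of_mem_take hv
    · exact List.mem_of_mem_drop (List.mem_reverse.1 hv)
  · rcases hbig.2 with h0 | h0
    · left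
      rw [h0] at hsplit
      conv_rhs => rw [hsplit]
      simp only [List.take_zero, List.nil_append]
      exact (List.reverse_perm _).append_left _
    · right
      simpa using h0

/-- Any two vertices different from `d` are joined by a walk that avoids `d`. -/
def Unseparated (G : SimpleGraph V) : Prop :=
  ∀ d x y : V, x ≠ d → y ≠ d → ∃ l : List V, l.IsChain G.Adj ∧ l.Nodup ∧ l.head? = some x ∧
    l.getLast? = some y ∧ d ∉ l

theorem TwoConnected.unseparated (h : TwoConnected G) : Unseparated G := by
  classical
  intro d x y hx hy
  obtain ⟨p, hp⟩ := ((h.2.2 d).preconnected ⟨x, by simpa using hx⟩ ⟨y, by simpa using hy⟩).exists_isPath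
  refine ⟨p.support.map Subtype.val, ?_, ?_, ?_, ?_, ?_⟩
  · rw [List.isChain_map]
    exact p.isChain_adj_support.imp fun a b hab => hab
  · exact hp.support_nodup.map Subtype.val_injective
  · rw [← p.cons_tail_support]; rfl
  · rw [List.getLast?_map, List.getLast?_eq_some_getLast p.support_ne_nil, p.getLast_support]; simp
  · intro hd
    obtain ⟨a, -, ha⟩ := List.mem_map.1 hd
    exact a.2 ha

/-- Take a path from `T` to `F` that avoids `d`, stop it at its first vertex in `F`, and start it at
the last vertex of `T` before that. -/
theorem Unseparated.exists_ear (h : Unseparated G) {T F : V → Prop} {d : V}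
    (hT : ∃ x, T x) (hF : ∃ x, F x) (hTF : ∀ x, T x → ¬ F x) (hTd : ¬ T d) (hFd : ¬ F d) :
    ∃ u μ w, T u ∧ F w ∧ IsPathList G (u :: (μ ++ [w])) ∧ d ∉ μ ∧ (∀ x ∈ μ, ¬ T x ∧ ¬ F x) := by
  obtain ⟨x, hx⟩ := hT
  obtain ⟨y, hy⟩ := hF
  obtain ⟨l, h1, h2, h3, h4, h5⟩ := h d x y (by rintro rfl; exact hTd hx) (by rintro rfl; exact hFd hy)
  have hxl : x ∈ l := List.mem_of_mem_head? h3
  have hyl : y ∈ l := List.mem_of_getLast? h4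
  obtain ⟨l₁, w, l₂, rfl, hw, hl₁⟩ := exists_first_split F l ⟨y, hyl, hy⟩
  have hxl₁ : x ∈ l₁ := by
    rcases l₁ with - | ⟨z, l₁⟩
    · simp at h3; subst h3; exact absurd hw (hTF _ hx)
    · simp at h3; simp [h3]
  obtain ⟨l₃, u, μ, rfl, hu, hμ⟩ := exists_last_split T l₁ ⟨x, hxl₁, hx⟩
  refine ⟨u, μ, w, hu, hw, ⟨?_, ?_⟩, ?_, fun z hz => ⟨hμ z hz, hl₁ z (by simp [hz])⟩⟩
  · have : l₃ ++ u :: μ ++ w :: l₂ = l₃ ++ ((u :: (μ ++ [w])) ++ l₂) := by simp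
    rw [this, List.isChain_append, List.isChain_append] at h1
    exact h1.2.1.1
  · have : l₃ ++ u :: μ ++ w :: l₂ = l₃ ++ ((u :: (μ ++ [w])) ++ l₂) := by simp
    rw [this, List.nodup_append, List.nodup_append] at h2
    exact h2.2.1.1
  · intro hd
    exact h5 (by simp [hd])

end Posa

/-! ### Two disjoint paths with one prescribed end on each side -/

section Linkage

variable {V : Type u} {G : SimpleGraph V}

/-- Two disjoint paths between `A` and `B`, one of them starting at `p` and one of them (possibly
the same one) ending at `q`. -/
structure Linkage (G : SimpleGraph V) (A B : V → Prop) (p q : V) (T₁ : List V) (a : V)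
    (T₂ : List V) (e₁ e₂ : V) : Prop where
  start : A a
  chain₁ : (p :: T₁).IsChain G.Adj
  chain₂ : (a :: (T₂ ++ [e₂])).IsChain G.Adj
  nodup : ((p :: T₁) ++ (a :: (T₂ ++ [e₂]))).Nodup
  last : (p :: T₁).getLast? = some e₁
  ends : e₁ = q ∧ B e₂ ∨ e₂ = q ∧ B e₁
  avoid₁ : ∀ v ∈ T₁, ¬ A v
  avoid₂ : ∀ v ∈ T₂ ++ [e₂], ¬ A v
  avoid₃ : ∀ v ∈ p :: T₁, B v → v = e₁
  avoid₄ : ∀ v ∈ a :: T₂, ¬ B v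

/-- A state of the augmentation that produces a linkage: `R ++ Z` and `S ++ [d]` start in `A`, one
of them at `p`; the former ends at `q`, and the latter at a vertex of `Z` or of `B`. -/
structure Partial (G : SimpleGraph V) (A B : V → Prop) (p q : V) (R Z S : List V) (d : V) :
    Prop where
  chain₁ : (R ++ Z).IsChain G.Adj
  chain₂ : (S ++ [d]).IsChain G.Adj
  nodup₁ : (R ++ Z).Nodup
  nodup₂ : (S ++ [d]).Nodup
  disj : ∀ v ∈ R, v ∉ S ∧ v ≠ d
  disjZ : ∀ v ∈ Z, v ∉ S
  last : (R ++ Z).getLast? = some q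
  avoid₁ : ∀ v ∈ R ++ Z, B v → v = q
  avoid₂ : ∀ v ∈ S, ¬ B v
  mem : d ∈ Z ∨ B d
  starts : (R.head? = some p ∧ ∃ a, S.head? = some a ∧ A a) ∨
    (S.head? = some p ∧ ∃ a, R.head? = some a ∧ A a)
  avoid₃ : ∀ v ∈ (R ++ Z).tail, ¬ A v
  avoid₄ : ∀ v ∈ (S ++ [d]).tail, ¬ A v

/-- If `d` is off `Z`, it lies in `B` and the two paths are already disjoint. A linkage lists the
path from `p` first, so the paths change places when it is `S` that starts at `p`. -/
theorem Partial.linkage_of_notMem {A B : V → Prop} {p q : V} {R Z S : List V} {d : V}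
    (h : Partial G A B p q R Z S d) (hAB : ∀ v, A v → B v → v = p ∧ v = q) (hBq : B q)
    (hd : d ∉ Z) :
    ∃ T₁ a T₂ e₁ e₂, Linkage G A B p q T₁ a T₂ e₁ e₂ := by
  obtain ⟨c1, c2, n1, n2, dj, djZ, la, av1, av2, mem, st, av3, av4⟩ := h
  have hBd : B d := mem.resolve_left hd
  rcases st with ⟨hR, a, hS, ha⟩ | ⟨hS, a, hR, ha⟩
  · obtain ⟨R', rfl⟩ := List.head?_eq_some_iff.1 hR
    obtain ⟨S', rfl⟩ := List.head?_eq_some_iff.1 hS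
    refine ⟨R' ++ Z, a, S', q, d, ha, c1, c2, ?_, la, Or.inl ⟨rfl, hBd⟩, av3, av4, av1, av2⟩
    simp only [List.nodup_append, List.cons_append, List.nodup_cons] at n1 n2 ⊢
    grind
  · obtain ⟨R', rfl⟩ := List.head?_eq_some_iff.1 hR
    obtain ⟨S', rfl⟩ := List.head?_eq_some_iff.1 hS
    obtain ⟨X, hX⟩ := List.getLast?_eq_some_iff.1 la
    rcases X with - | ⟨x, X⟩
    · simp at hX
      obtain ⟨rfl, rfl, rfl⟩ := hX
      exact absurd ((hAB a ha hBq).1 ▸ hBq) (av2 p (by simp))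
    · obtain ⟨rfl, hX⟩ := List.cons.inj hX
      have hX' : a :: R' ++ Z = a :: (X ++ [q]) := hX
      rw [hX'] at c1 n1 la av1 av3
      have djX : ∀ v ∈ a :: (X ++ [q]), v ∉ p :: S' ∧ v ≠ d := by
        rw [← hX']
        intro v hv
        rcases List.mem_append.1 hv with hv | hv
        · exact dj v hv
        · exact ⟨djZ v hv, fun h => hd (h ▸ hv)⟩
      refine ⟨S' ++ [d], a, X, d, q, ha, c2, c1, ?_,
        List.getLast?_concat (l := p :: S'), Or.inr ⟨rfl, hBd⟩, av4, av3, ?_, ?_⟩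
      · have := (List.perm_append_comm (l₁ := p :: (S' ++ [d])) (l₂ := a :: (X ++ [q]))).nodup_iff
        refine this.2 (List.nodup_append.2 ⟨n1, n2, fun v hv w hw => ?_⟩)
        rintro rfl
        obtain ⟨h1, h2⟩ := djX v hv
        rcases List.mem_append.1 (show v ∈ p :: S' ++ [d] from hw) with h | h
        · exact h1 h
        · exact h2 (by simpa using h)
      · intro v hv hBv
        rcases List.mem_append.1 (show v ∈ p :: S' ++ [d] from hv) with h | h
        · exact absurd hBv (av2 v h)
        · simpa using h
      · intro v hv hBv
        have h1 := av1 v (by simp at hv ⊢; tauto) hBv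
        subst h1
        have := (List.nodup_append (l₁ := a :: X)).1 n1
        exact this.2.2 v hv v (by simp) rfl

/-- The exchange in an augmentation step: `X`, which arrives at `d`, takes over the remaining way
`Z` to `q`, while `Y` with its end `w` becomes the path still to be completed. -/
theorem Partial.of_disjoint {A B : V → Prop} {p q x y d w : V} {X Y Z : List V}
    (cX : (X ++ [d]).IsChain G.Adj) (cY : (Y ++ [w]).IsChain G.Adj) (cZ : (d :: Z).IsChain G.Adj)
    (nX : X.Nodup) (nY : Y.Nodup) (nZ : (d :: Z).Nodup)
    (hX : ∀ v ∈ X, v ≠ d ∧ v ≠ w ∧ v ∉ Z ∧ ¬ B v) (hY : ∀ v ∈ Y, v ≠ d ∧ v ≠ w ∧ v ∉ Z ∧ ¬ B v)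
    (hXY : ∀ v ∈ X, v ∉ Y) (hwd : w ≠ d) (hlast : (d :: Z).getLast? = some q)
    (hBZ : ∀ v ∈ d :: Z, B v → v = q) (hw : w ∈ Z ∨ B w) (hx : X.head? = some x)
    (hy : Y.head? = some y) (hxy : x = p ∧ A y ∨ y = p ∧ A x) (hAX : ∀ v ∈ X.tail, ¬ A v)
    (hAY : ∀ v ∈ Y.tail, ¬ A v) (hAZ : ∀ v ∈ d :: Z, ¬ A v) (hAw : ¬ A w) :
    Partial G A B p q (X ++ [d]) Z Y w := by
  obtain ⟨X, rfl⟩ := List.head?_eq_some_iff.1 hx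
  obtain ⟨Y, rfl⟩ := List.head?_eq_some_iff.1 hy
  refine ⟨?_, cY, ?_, ?_, ?_, ?_, ?_, ?_, ?_, hw, ?_, ?_, ?_⟩
  · rw [List.append_assoc, List.singleton_append, List.isChain_split]
    exact ⟨cX, cZ⟩
  · rw [List.append_assoc, List.singleton_append]
    refine List.nodup_append.2 ⟨nX, nZ, fun v hv v' hv' => ?_⟩
    rintro rfl
    rcases List.mem_cons.1 hv' with h | h
    · exact (hX v hv).1 h
    · exact (hX v hv).2.2.1 h
  · refine List.nodup_append.2 ⟨nY, by simp, fun v hv v' hv' => ?_⟩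
    rintro rfl
    exact (hY v hv).2.1 (by simpa using hv')
  · intro v hv
    rcases List.mem_append.1 hv with h | h
    · exact ⟨hXY v h, (hX v h).2.1⟩
    · simp only [List.mem_singleton] at h
      subst h
      exact ⟨fun h' => (hY v h').1 rfl, hwd.symm⟩
  · exact fun v hv hv' => (hY v hv').2.2.1 hv
  · rw [List.append_assoc, List.singleton_append, List.getLast?_append_of_ne_nil _ (by simp)]
    exact hlast
  · intro v hv
    rw [List.append_assoc, List.singleton_append] at hv
    rcases List.mem_append.1 hv with h | h
    · exact fun h' => absurd h' (hX v h).2.2.2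
    · exact hBZ v h
  · exact fun v hv => (hY v hv).2.2.2
  · rcases hxy with ⟨rfl, h⟩ | ⟨rfl, h⟩
    · exact Or.inl ⟨rfl, y, rfl, h⟩
    · exact Or.inr ⟨rfl, x, rfl, h⟩
  · intro v hv
    rw [List.append_assoc, List.singleton_append] at hv
    rcases List.mem_append.1 hv with h | h
    · exact hAX v h
    · exact hAZ v h
  · intro v hv
    rcases List.mem_append.1 hv with h | h
    · exact hAY v h
    · simp only [List.mem_singleton] at h
      subst h
      exact hAw

theorem head?_append_cons_congr {α β γ : List V} {u : V} :
    (α ++ u :: β).head? = (α ++ u :: γ).head? := by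
  cases α <;> rfl

theorem mem_append_cons_or {α β γ : List V} {u v : V} (h : v ∈ α ++ u :: β) :
    v ∈ α ++ u :: γ ∨ v ∈ β := by
  simp at h ⊢; tauto

theorem mem_tail_append_cons {α β γ : List V} {u v : V} (h : v ∈ (α ++ u :: β).tail) :
    v ∈ (α ++ u :: γ).tail ∨ v ∈ β := by
  cases α <;> simp at h ⊢ <;> tauto

/-- Augmentation as in Menger's theorem for two paths. While the second path runs into the first at
`d`, an ear avoiding `d` leads from `A` or the parts of the paths before `d` to `B` or the part `Z₂`
beyond `d`. One path is then routed through `d` into `Z₂`, and the ear gives the other one. Since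
`Z₂` is shorter than `Z`, induction on the length of `Z` finishes. -/
theorem Partial.exists_linkage (hG : Unseparated G) {A B : V → Prop} {p q : V}
    (hAB : ∀ v, A v → B v → v = p ∧ v = q) (hBq : B q) (hB : ∃ b, B b ∧ b ≠ q) :
    ∀ (n : ℕ) (R Z S : List V) (d : V), Z.length ≤ n → Partial G A B p q R Z S d →
      ∃ T₁ a T₂ e₁ e₂, Linkage G A B p q T₁ a T₂ e₁ e₂ := by
  intro n
  induction n with
  | zero =>
    intro R Z S d hZ h
    refine h.linkage_of_notMem hAB hBq ?_
    simp at hZ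
    simp [hZ]
  | succ n ih =>
    intro R Z S d hZ h
    by_cases hd : d ∈ Z
    swap
    · exact h.linkage_of_notMem hAB hBq hd
    obtain ⟨Z₁, Z₂, rfl⟩ := List.append_of_mem hd
    obtain ⟨c1, c2, n1, n2, dj, djZ, la, av1, av2, mem, st, av3, av4⟩ := h
    have hRne : R ≠ [] := by rintro rfl; simp at st
    have hSne : S ≠ [] := by rintro rfl; simp at st
    obtain ⟨r, R, rfl⟩ := List.exists_cons_of_ne_nil hRne
    obtain ⟨s, S, rfl⟩ := List.exists_cons_of_ne_nil hSne
    simp only [List.cons_append, List.tail_cons, List.head?_cons, Option.some.injEq] at st av3 av4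
    have hqZ : q = d ∨ q ∈ Z₂ := by
      have := List.mem_of_getLast? (l := d :: Z₂) (a := q)
        (by rw [← la, ← List.append_assoc]; exact (List.getLast?_append_of_ne_nil _ (by simp)).symm)
      simpa using this
    have hdA : ¬ A d := av3 d (by simp)
    have hqA : ¬ A q := av3 q (by rcases hqZ with rfl | h <;> simp [*])
    have hAB' : ∀ v, A v → ¬ B v := fun v hv hv' => by
      have := (hAB v hv hv').2
      subst this
      exact hqA hv
    have hnd : ((r :: R ++ Z₁) ++ d :: Z₂).Nodup := by simpa using n1
    have hnd1 := List.nodup_append.1 hnd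
    have hnd2 := List.nodup_cons.1 hnd1.2.1
    have hnd3 := List.nodup_append.1 n2
    have hTF : ∀ v, (v ≠ d ∧ (A v ∨ v ∈ r :: R ++ Z₁ ∨ v ∈ s :: S)) → ¬ (v ≠ d ∧ (v ∈ Z₂ ∨ B v)) := by
      rintro x ⟨hx, h1⟩ ⟨-, h2⟩
      rcases h2 with h2 | h2
      · rcases h1 with h1 | h1 | h1
        · exact av3 x (by simp [h2]) h1
        · exact hnd1.2.2 x h1 x (by simp [h2]) rfl
        · exact djZ x (by simp [h2]) h1
      · rcases h1 with h1 | h1 | h1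
        · exact hAB' x h1 h2
        · have := av1 x (by rw [← List.append_assoc]; exact List.mem_append_left _ h1) h2
          subst this
          exact hnd1.2.2 x h1 x (by simpa using hqZ) rfl
        · exact av2 x h1 h2
    obtain ⟨u, μ, w, hu, hw, hear, hdμ, hμ⟩ := hG.exists_ear (d := d)
      (T := fun v => v ≠ d ∧ (A v ∨ v ∈ r :: R ++ Z₁ ∨ v ∈ s :: S))
      (F := fun v => v ≠ d ∧ (v ∈ Z₂ ∨ B v))
      ⟨r, (dj r (by simp)).2, Or.inr (Or.inl (by simp))⟩
      (by
        obtain ⟨b, hb, hbq⟩ := hB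
        refine ⟨b, ?_, Or.inr hb⟩
        rintro rfl
        exact hbq (av1 _ (by simp) hb))
      hTF (by simp) (by simp)
    simp only [not_and, not_or] at hμ
    have hμA : ∀ v ∈ μ, ¬ A v := fun v hv => ((hμ v hv).1 (by rintro rfl; exact hdμ hv)).1
    have hμR : ∀ v ∈ μ, v ∉ r :: R ++ Z₁ := fun v hv => ((hμ v hv).1 (by rintro rfl; exact hdμ hv)).2.1
    have hμS : ∀ v ∈ μ, v ∉ s :: S := fun v hv => ((hμ v hv).1 (by rintro rfl; exact hdμ hv)).2.2
    have hμZ : ∀ v ∈ μ, v ∉ Z₂ := fun v hv => ((hμ v hv).2 (by rintro rfl; exact hdμ hv)).1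
    have hμB : ∀ v ∈ μ, ¬ B v := fun v hv => ((hμ v hv).2 (by rintro rfl; exact hdμ hv)).2
    obtain ⟨hec, hen⟩ := hear
    have hen1 := List.nodup_cons.1 hen
    have hen2 := List.nodup_append.1 hen1.2
    have hwA : ¬ A w := by
      rcases hw.2 with h | h
      · exact av3 w (by simp [h])
      · exact fun h' => hAB' w h' h
    have hnR : ∀ v ∈ r :: R ++ Z₁, v ≠ d := fun v hv => hnd1.2.2 v hv d (by simp)
    have hnS : ∀ v ∈ s :: S, v ≠ d := fun v hv => hnd3.2.2 v hv d (by simp)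
    have hF : ∀ v, v ≠ d → (v ∈ r :: R ++ Z₁ ∨ v ∈ s :: S) → v ≠ w ∧ v ∉ Z₂ ∧ ¬ B v := by
      intro v hv h
      have h1 := hTF v ⟨hv, Or.inr h⟩
      refine ⟨?_, fun h' => h1 ⟨hv, Or.inl h'⟩, fun h' => h1 ⟨hv, Or.inr h'⟩⟩
      rintro rfl
      exact h1 hw
    have hFR : ∀ v ∈ r :: R ++ Z₁, v ≠ d ∧ v ≠ w ∧ v ∉ Z₂ ∧ ¬ B v := fun v hv =>
      ⟨hnR v hv, hF v (hnR v hv) (Or.inl hv)⟩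
    have hFS : ∀ v ∈ s :: S, v ≠ d ∧ v ≠ w ∧ v ∉ Z₂ ∧ ¬ B v := fun v hv =>
      ⟨hnS v hv, hF v (hnS v hv) (Or.inr hv)⟩
    have hFμ : ∀ v ∈ u :: μ, v ≠ d ∧ v ≠ w ∧ v ∉ Z₂ ∧ ¬ B v := by
      intro v hv
      rcases List.mem_cons.1 hv with rfl | hv
      · have h1 := hTF v hu
        refine ⟨hu.1, ?_, fun h' => h1 ⟨hu.1, Or.inl h'⟩, fun h' => h1 ⟨hu.1, Or.inr h'⟩⟩
        rintro rfl
        exact h1 hw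
      · exact ⟨fun h => hdμ (h ▸ hv), hen2.2.2 v hv w (by simp), hμZ v hv, hμB v hv⟩
    have hRS : ∀ v ∈ r :: R ++ Z₁, v ∉ s :: S := by
      intro v hv
      rcases List.mem_append.1 hv with hv | hv
      · exact (dj v hv).1
      · exact djZ v (by simp [hv])
    have hcRd : (r :: R ++ Z₁ ++ [d]).IsChain G.Adj := by
      have : r :: R ++ (Z₁ ++ d :: Z₂) = (r :: R ++ Z₁ ++ [d]) ++ Z₂ := by simp
      rw [this, List.isChain_append] at c1
      exact c1.1
    have hcd : (d :: Z₂).IsChain G.Adj := by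
      have : r :: R ++ (Z₁ ++ d :: Z₂) = (r :: R ++ Z₁) ++ (d :: Z₂) := by simp
      rw [this, List.isChain_append] at c1
      exact c1.2.1
    have hlad : (d :: Z₂).getLast? = some q := by
      rw [← la, ← List.append_assoc, List.getLast?_append_of_ne_nil _ (by simp)]
    have hBZ : ∀ v ∈ d :: Z₂, B v → v = q := fun v hv =>
      av1 v (List.mem_append_right _ (List.mem_append_right _ hv))
    have hAZ : ∀ v ∈ d :: Z₂, ¬ A v := fun v hv =>
      av3 v (List.mem_append_right _ (List.mem_append_right _ hv))
    have hAR : ∀ v ∈ (r :: R ++ Z₁).tail, ¬ A v := fun v hv =>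
      av3 v (by rw [← List.append_assoc]; exact List.mem_append_left _ hv)
    have hAS : ∀ v ∈ (s :: S).tail, ¬ A v := fun v hv => av4 v (List.mem_append_left _ hv)
    have hlen : Z₂.length ≤ n := by simp at hZ; omega
    -- cutting a path at `u` and continuing it along the ear
    have splice : ∀ α β, (α ++ u :: β ++ [d]).IsChain G.Adj → (α ++ u :: β).Nodup →
        (∀ v ∈ α ++ u :: β, v ∉ μ) →
        (α ++ u :: μ ++ [w]).IsChain G.Adj ∧ (α ++ u :: μ).Nodup := by
      intro α β h1 h2 h3
      have h4 : (α ++ [u]).IsChain G.Adj := by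
        have : α ++ u :: β ++ [d] = (α ++ [u]) ++ (β ++ [d]) := by simp
        rw [this, List.isChain_append] at h1
        exact h1.1
      have h5 := List.nodup_append.1 h2
      refine ⟨?_, List.nodup_append.2 ⟨h5.1, ?_, fun v hv v' hv' => ?_⟩⟩
      · rw [List.append_assoc, List.cons_append, List.isChain_split]
        exact ⟨h4, hec⟩
      · exact (List.nodup_append.1 (show ((u :: μ) ++ [w]).Nodup from hen)).1
      · rintro rfl
        rcases List.mem_cons.1 hv' with rfl | h
        · exact h5.2.2 v hv v (by simp) rfl
        · exact h3 v (by simp [hv]) h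
    -- If the ear leaves the path to `q` before `d`, that path turns off along the ear, and `S`
    -- continues through `d` to `q` instead.
    by_cases huR : u ∈ r :: R ++ Z₁
    · obtain ⟨α, β, hαβ⟩ := List.append_of_mem huR
      have hsub : ∀ v ∈ α ++ u :: μ, v ∈ r :: R ++ Z₁ ∨ v ∈ μ := by
        rw [hαβ]; exact fun v hv => mem_append_cons_or hv
      obtain ⟨h1, h2⟩ := splice α β (by rw [← hαβ]; exact hcRd) (by rw [← hαβ]; exact hnd1.1)
        (fun v hv hv' => hμR v hv' (by rw [hαβ]; exact hv))
      refine ih _ _ _ _ hlen (Partial.of_disjoint (X := s :: S) (Y := α ++ u :: μ) (x := s) (y := r)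
        c2 h1 hcd hnd3.1 h2 hnd1.2.1 hFS ?_ ?_ hw.1 hlad hBZ hw.2 rfl ?_ ?_ hAS ?_ hAZ hwA)
      · intro v hv
        rcases hsub v hv with h | h
        · exact hFR v h
        · exact hFμ v (by simp [h])
      · intro v hv hv'
        rcases hsub v hv' with h | h
        · exact hRS v h hv
        · exact hμS v h hv
      · rw [head?_append_cons_congr (γ := β), ← hαβ]; rfl
      · rcases st with ⟨rfl, a, rfl, h⟩ | ⟨rfl, a, rfl, h⟩
        · exact Or.inr ⟨rfl, h⟩
        · exact Or.inl ⟨rfl, h⟩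
      · intro v hv
        rcases mem_tail_append_cons (γ := β) hv with h | h
        · exact hAR v (by rw [hαβ]; exact h)
        · exact hμA v h
    by_cases huS : u ∈ s :: S
    · obtain ⟨α, β, hαβ⟩ := List.append_of_mem huS
      have hsub : ∀ v ∈ α ++ u :: μ, v ∈ s :: S ∨ v ∈ μ := by
        rw [hαβ]; exact fun v hv => mem_append_cons_or hv
      obtain ⟨h1, h2⟩ := splice α β (by rw [← hαβ]; exact c2) (by rw [← hαβ]; exact hnd3.1)
        (fun v hv hv' => hμS v hv' (by rw [hαβ]; exact hv))
      refine ih _ _ _ _ hlen (Partial.of_disjoint (X := r :: R ++ Z₁) (Y := α ++ u :: μ) (x := r)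
        (y := s) hcRd h1 hcd hnd1.1 h2 hnd1.2.1 hFR ?_ ?_ hw.1 hlad hBZ hw.2 rfl ?_ ?_ hAR ?_ hAZ hwA)
      · intro v hv
        rcases hsub v hv with h | h
        · exact hFS v h
        · exact hFμ v (by simp [h])
      · intro v hv hv'
        rcases hsub v hv' with h | h
        · exact hRS v hv h
        · exact hμR v h hv
      · rw [head?_append_cons_congr (γ := β), ← hαβ]; rfl
      · rcases st with ⟨rfl, a, rfl, h⟩ | ⟨rfl, a, rfl, h⟩
        · exact Or.inl ⟨rfl, h⟩
        · exact Or.inr ⟨rfl, h⟩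
      · intro v hv
        rcases mem_tail_append_cons (γ := β) hv with h | h
        · exact hAS v (by rw [hαβ]; exact h)
        · exact hμA v h
    have huA : A u := by
      rcases hu.2 with h | h | h
      · exact h
      · exact absurd h huR
      · exact absurd h huS
    have hnμ : (u :: μ).Nodup := (List.nodup_append.1 (show ((u :: μ) ++ [w]).Nodup from hen)).1
    -- The ear starts at a new vertex of `A`: it replaces the path that does not start at `p`.
    rcases st with ⟨rfl, -⟩ | ⟨rfl, -⟩
    · refine ih _ _ _ _ hlen (Partial.of_disjoint (X := r :: R ++ Z₁) (Y := u :: μ) (x := r)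
        (y := u) hcRd hec hcd hnd1.1 hnμ hnd1.2.1 hFR hFμ ?_ hw.1 hlad hBZ hw.2 rfl rfl
        (Or.inl ⟨rfl, huA⟩) hAR hμA hAZ hwA)
      intro v hv hv'
      rcases List.mem_cons.1 hv' with rfl | h
      · exact huR hv
      · exact hμR v h hv
    · refine ih _ _ _ _ hlen (Partial.of_disjoint (X := s :: S) (Y := u :: μ) (x := s)
        (y := u) c2 hec hcd hnd3.1 hnμ hnd1.2.1 hFS hFμ ?_ hw.1 hlad hBZ hw.2 rfl rfl
        (Or.inl ⟨rfl, huA⟩) hAS hμA hAZ hwA)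
      intro v hv hv'
      rcases List.mem_cons.1 hv' with rfl | h
      · exact huS hv
      · exact hμS v h hv

end Linkage

/-! ### Pósa's lemma -/

section PosaLemma

variable {V : Type u} {G : SimpleGraph V}

theorem isChain_glue {X Y : List V} {c : V} (hX : X.IsChain G.Adj) (hc : X.getLast? = some c)
    (hY : (c :: Y).IsChain G.Adj) :
    (X ++ Y).IsChain G.Adj ∧ (X ++ Y).getLast? = (c :: Y).getLast? := by
  obtain ⟨X, rfl⟩ := List.getLast?_eq_some_iff.1 hc
  rw [List.append_assoc, List.singleton_append]
  exact ⟨List.isChain_split.2 ⟨hX, hY⟩, List.getLast?_append_of_ne_nil _ (by simp)⟩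

theorem IsCycleList.of_isChain_append {m : List V} {a : V} (h : (m ++ [a]).IsChain G.Adj)
    (ha : m.head? = some a) (hn : m.Nodup) (h3 : 3 ≤ m.length) : IsCycleList G m := by
  rw [List.isChain_append] at h
  refine ⟨h3, hn, h.1, fun x hx y hy => h.2.2 x hx y ?_⟩
  rw [ha] at hy
  simpa using hy

/-- Along a path starting at `x`, one can travel from a vertex `a` to the last neighbour `p` of
`x`, passing through all neighbours of `x`. -/
theorem IsPathList.exists_isPathList_through {L : List V} (hL : IsPathList G L) {x p a : V}
    (hx : L.head? = some x) (hp : L.getLast? = some p) (N : Finset V)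
    (hN : ∀ v ∈ N, v ∈ L ∧ G.Adj x v) (hpN : p ∈ N) (ha : a ∈ L) (hap : a ≠ p) :
    ∃ Q, IsPathList G Q ∧ Q.head? = some a ∧ Q.getLast? = some p ∧ (∀ v ∈ Q, v ∈ L) ∧
      N.card + 1 ≤ Q.length := by
  classical
  obtain ⟨α, β, rfl⟩ := List.append_of_mem ha
  have hβ : β ≠ [] := by
    rintro rfl
    simp at hp
    exact hap hp
  have hpβ : p ∈ β := by
    obtain ⟨b, β, rfl⟩ := List.exists_cons_of_ne_nil hβ
    rw [List.getLast?_append_of_ne_nil _ (by simp), List.getLast?_cons_cons] at hp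
    exact List.mem_of_getLast? hp
  -- The route: from `a` back to `x`, over to the first neighbour `b ∈ N` of `x` after `a`, and on
  -- to `p`. The skipped part `β₁` misses `N`.
  obtain ⟨β₁, b, β₂, rfl, hb, hβ₁⟩ := exists_first_split (· ∈ N) β ⟨p, hpβ, hpN⟩
  have hc := hL.chain
  have hn := hL.nodup
  have hre : α ++ a :: (β₁ ++ b :: β₂) = (α ++ [a]) ++ (β₁ ++ b :: β₂) := by simp
  have hxa : (α ++ [a]).head? = some x := by
    rw [← hx]; exact head?_append_cons_congr
  have hnodup : ((α ++ [a]).reverse ++ b :: β₂).Nodup := by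
    rw [hre, List.nodup_append] at hn
    refine List.nodup_append.2 ⟨List.nodup_reverse.2 hn.1, (List.nodup_append.1 hn.2.1).2.1, fun v hv w hw => ?_⟩
    exact hn.2.2 v (List.mem_reverse.1 hv) w (List.mem_append_right _ hw)
  refine ⟨(α ++ [a]).reverse ++ b :: β₂, ⟨?_, hnodup⟩, by simp, ?_, ?_, ?_⟩
  · rw [hre, List.isChain_append] at hc
    rw [List.isChain_append, isChain_adj_reverse]
    refine ⟨hc.1, (List.isChain_append.1 hc.2.1).2.1, fun v hv w hw => ?_⟩
    rw [List.getLast?_reverse, hxa] at hv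
    simp at hv hw
    subst hv hw
    exact (hN _ hb).2
  · rw [← hp, hre, ← List.append_assoc, List.getLast?_append_of_ne_nil _ (by simp),
      List.getLast?_append_of_ne_nil _ (by simp)]
  · intro v hv
    simp at hv ⊢
    tauto
  · have hsub : insert x N ⊆ ((α ++ [a]).reverse ++ b :: β₂).toFinset := by
      intro v hv
      rw [List.mem_toFinset]
      rcases Finset.mem_insert.1 hv with rfl | hv
      · exact List.mem_append_left _ (List.mem_reverse.2 (List.mem_of_mem_head? hxa))
      · have h1 := (hN v hv).1
        have h2 := hβ₁ v
        rw [hre] at h1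
        simp only [List.mem_append, List.mem_reverse] at h1 ⊢
        tauto
    have hxN : x ∉ N := fun h => (hN x h).2.ne rfl
    have := Finset.card_le_card hsub
    rwa [Finset.card_insert_of_notMem hxN, List.toFinset_card_of_nodup hnodup] at this

/-- Pósa's lemma: in a graph without cut vertices, a path whose ends have `d₁` and `d₂` neighbours
on it forces a cycle that is as long as the path or has length at least `d₁ + d₂`. -/
theorem Unseparated.exists_isCycleList [DecidableEq V] (hG : Unseparated G) {l : List V}
    (h : IsPathList G l) (hl : 3 ≤ l.length) {x y : V} (hx : l.head? = some x)
    (hy : l.getLast? = some y) (N₁ N₂ : Finset V) (h1 : ∀ v ∈ N₁, v ∈ l ∧ G.Adj x v)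
    (h2 : ∀ v ∈ N₂, v ∈ l ∧ G.Adj v y) (hN₁ : N₁.Nonempty) (hN₂ : N₂.Nonempty)
    (h3 : 3 ≤ N₁.card + N₂.card) :
    ∃ m, IsCycleList G m ∧ (l.length ≤ m.length ∨ N₁.card + N₂.card ≤ m.length) := by
  by_cases hcr : ∃ a ∈ N₂, ∃ b ∈ N₁, l.idxOf a < l.idxOf b
  · obtain ⟨m, hm, -, hml⟩ := h.exists_isCycleList_of_cross hl hx hy N₁ N₂ h1 h2 h3 (Or.inr hcr)
    exact ⟨m, hm, hml.imp (fun e => e.length_eq.ge) id⟩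
  push Not at hcr
  obtain ⟨n₁, hn₁⟩ := hN₁
  obtain ⟨n₂, hn₂⟩ := hN₂
  -- Without a crossing no vertex of `N₂` precedes a vertex of `N₁`. Let `p` be the last vertex of
  -- `N₁` and `q` the first of `N₂`; `p = q` is possible.
  obtain ⟨L₁, p, L', rfl, hp, hL'⟩ := exists_last_split (· ∈ N₁) l ⟨n₁, (h1 _ hn₁).1, hn₁⟩
  have hnd := List.nodup_append.1 h.nodup
  have hN₂L : ∀ v ∈ N₂, v ∈ p :: L' := by
    intro v hv
    rcases List.mem_append.1 (h2 v hv).1 with h4 | h4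
    · have h5 := hcr v hv p hp
      rw [List.idxOf_append_of_mem h4, List.idxOf_append_of_notMem
        (fun h' => hnd.2.2 p h' p (by simp) rfl), List.idxOf_cons_self] at h5
      have := List.idxOf_lt_length_iff.2 h4
      omega
    · exact h4
  obtain ⟨M, q, L₂, hM, hq, hMN⟩ := exists_first_split (· ∈ N₂) (p :: L') ⟨n₂, hN₂L _ hn₂, hn₂⟩
  obtain ⟨Z, hZ⟩ : ∃ Z, M ++ [q] = p :: Z := by
    rcases M with - | ⟨r, M⟩
    · simp at hM; exact ⟨[], by simp [hM.1]⟩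
    · have := (List.cons.inj hM).1
      exact ⟨M ++ [q], by rw [this]; rfl⟩
  have hL'Z : L' = Z ++ L₂ := by
    have : p :: L' = p :: (Z ++ L₂) := by
      rw [hM, ← List.cons_append, ← hZ]; simp
    exact (List.cons.inj this).2
  have hqZ : (p :: Z).getLast? = some q := by rw [← hZ]; simp
  have hqmem : q ∈ p :: Z := List.mem_of_getLast? hqZ
  have hL₁ : L₁ ≠ [] := by
    rintro rfl
    simp at hx
    exact (h1 p hp).2.ne hx.symm
  have hL₂ : L₂ ≠ [] := by
    rintro rfl
    rw [List.getLast?_append_of_ne_nil _ (by simp), hM] at hy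
    simp at hy
    exact (h2 q hq).2.ne hy
  subst hL'Z
  have hl2 : L₁ ++ p :: (Z ++ L₂) = (L₁ ++ p :: Z) ++ L₂ := by simp
  have hl3 : L₁ ++ p :: (Z ++ L₂) = (L₁ ++ M) ++ q :: L₂ := by rw [hM]; simp
  have dL₁ : ∀ v ∈ L₁, v ≠ p ∧ v ∉ Z ∧ v ∉ L₂ := fun v hv =>
    ⟨hnd.2.2 v hv p (by simp), fun h' => hnd.2.2 v hv v (by simp [h']) rfl,
      fun h' => hnd.2.2 v hv v (by simp [h']) rfl⟩
  have hnd2 := List.nodup_append.1 (hl2 ▸ h.nodup)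
  have dL₂ : ∀ v ∈ L₂, v ∉ p :: Z := fun v hv h' => hnd2.2.2 v (List.mem_append_right _ h') v hv rfl
  have hpZ : p ∉ Z := fun h' => by
    have := (List.nodup_cons.1 hnd.2.1).1
    exact this (List.mem_append_left _ h')
  have hnd3 := List.nodup_append.1 hnd2.1
  have hch2 := List.isChain_append.1 (hl2 ▸ h.chain)
  have hch3 := List.isChain_append.1 hch2.1
  -- The augmentation starts from the segment of the path between `p` and `q` together with an ear
  -- that bypasses `p`.
  obtain ⟨u, μ, w, hu, hw, hear, hpμ, hμ⟩ := hG.exists_ear (d := p) (T := (· ∈ L₁))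
    (F := fun v => v ∈ Z ∨ v ∈ L₂)
    (by obtain ⟨r, L, rfl⟩ := List.exists_cons_of_ne_nil hL₁; exact ⟨r, by simp⟩)
    (by obtain ⟨r, L, rfl⟩ := List.exists_cons_of_ne_nil hL₂; exact ⟨r, by simp⟩)
    (fun v hv h' => h'.elim (dL₁ v hv).2.1 (dL₁ v hv).2.2)
    (fun h' => (dL₁ p h').1 rfl)
    (fun h' => h'.elim hpZ fun h' => dL₂ p h' (by simp))
  have huμ : ∀ v ∈ u :: μ, v ≠ p ∧ v ∉ Z ∧ v ∉ L₂ := by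
    intro v hv
    rcases List.mem_cons.1 hv with rfl | hv
    · exact dL₁ v hu
    · exact ⟨fun h' => hpμ (h' ▸ hv), fun h' => (hμ v hv).2 (Or.inl h'),
        fun h' => (hμ v hv).2 (Or.inr h')⟩
  have hwp : w ≠ p := by
    rintro rfl
    exact hw.elim hpZ fun h' => dL₂ w h' (by simp)
  set A : V → Prop := fun v => v ∈ L₁ ∨ v = p with hA
  set B : V → Prop := fun v => v ∈ L₂ ∨ v = q with hB
  have hZA : ∀ v ∈ Z, ¬ A v := by
    rintro v hv (h' | rfl)
    · exact (dL₁ v h').2.1 hv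
    · exact hpZ hv
  have hAB : ∀ v, A v → B v → v = p ∧ v = q := by
    rintro v (h4 | rfl) (h5 | rfl)
    · exact absurd h5 (dL₁ v h4).2.2
    · rcases List.mem_cons.1 hqmem with h6 | h6
      · exact absurd h6 (dL₁ v h4).1
      · exact absurd h6 (dL₁ v h4).2.1
    · exact absurd (by simp) (dL₂ v h5)
    · exact ⟨rfl, rfl⟩
  have hpart : Partial G A B p q [p] Z (u :: μ) w := by
    refine ⟨hch3.2.1, hear.chain, hnd3.2.1, hear.nodup, ?_, ?_, hqZ, ?_, ?_, ?_, ?_, hZA, ?_⟩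
    · intro v hv
      simp only [List.mem_singleton] at hv
      subst hv
      exact ⟨fun h' => (huμ v h').1 rfl, hwp.symm⟩
    · exact fun v hv hv' => (huμ v hv').2.1 hv
    · rintro v hv (h4 | h4)
      · exact absurd hv (dL₂ v h4)
      · exact h4
    · rintro v hv (h4 | rfl)
      · exact (huμ v hv).2.2 h4
      · rcases List.mem_cons.1 hqmem with h6 | h6
        · exact (huμ v hv).1 h6
        · exact (huμ v hv).2.1 h6
    · exact hw.imp id Or.inl
    · exact Or.inl ⟨rfl, u, rfl, Or.inl hu⟩
    · intro v hv
      rcases List.mem_append.1 (show v ∈ μ ++ [w] from hv) with h4 | h4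
      · rintro (h5 | h5)
        · exact (hμ v h4).1 h5
        · exact hpμ (h5 ▸ h4)
      · simp only [List.mem_singleton] at h4
        subst h4
        rintro (h5 | h5)
        · exact hw.elim (dL₁ v h5).2.1 (dL₁ v h5).2.2
        · exact hwp h5
  obtain ⟨T₁, a, T₂, e₁, e₂, hk⟩ := Partial.exists_linkage hG hAB (Or.inr rfl)
    (by
      obtain ⟨r, L, rfl⟩ := List.exists_cons_of_ne_nil hL₂
      refine ⟨r, Or.inl (by simp), ?_⟩
      rintro rfl
      exact dL₂ r (by simp) hqmem) _ _ _ _ _ le_rfl hpart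
  have hkn := List.nodup_append.1 hk.nodup
  have hap : a ≠ p := (hkn.2.2 p (by simp) a (by simp)).symm
  have he : e₁ ≠ e₂ := hkn.2.2 e₁ (List.mem_of_getLast? hk.last) e₂ (by simp)
  have hpe₂ : p ≠ e₂ := hkn.2.2 p (by simp) e₂ (by simp)
  have haL₁ : a ∈ L₁ := hk.start.resolve_right hap
  -- the route in `A`
  obtain ⟨PA, hPA, hPAa, hPAp, hPAsub, hPAlen⟩ :=
    IsPathList.exists_isPathList_through (L := L₁ ++ [p]) (x := x) (p := p) (a := a)
      ⟨by
        have : L₁ ++ p :: Z = (L₁ ++ [p]) ++ Z := by simp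
        rw [this, List.isChain_append] at hch2
        exact hch2.1.1,
       by
        have : L₁ ++ p :: Z = (L₁ ++ [p]) ++ Z := by simp
        rw [this, List.nodup_append] at hnd2
        exact hnd2.1.1⟩
      (by rw [← hx]; exact head?_append_cons_congr) (by simp) N₁
      (fun v hv => ⟨by
        have h4 := (h1 v hv).1
        have h5 := hL' v
        simp only [List.mem_append, List.mem_cons] at h4 h5 ⊢
        tauto, (h1 v hv).2⟩) hp (List.mem_append_left _ haL₁) hap
  -- the route in `B`
  have hbq : ∃ b, b ∈ L₂ ∧ (e₁ = q ∧ e₂ = b ∨ e₂ = q ∧ e₁ = b) := by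
    rcases hk.ends with ⟨rfl, h4⟩ | ⟨rfl, h4⟩
    · exact ⟨e₂, h4.resolve_right he.symm, Or.inl ⟨rfl, rfl⟩⟩
    · exact ⟨e₁, h4.resolve_right he, Or.inr ⟨rfl, rfl⟩⟩
  have hch4 := List.isChain_append.1 (hl3 ▸ h.chain)
  have hnd4 := List.nodup_append.1 (hl3 ▸ h.nodup)
  obtain ⟨U, hU, hUe, hUsub, hUlen⟩ : ∃ U, IsPathList G (e₁ :: U) ∧ (e₁ :: U).getLast? = some e₂ ∧
      (∀ v ∈ e₁ :: U, B v) ∧ N₂.card ≤ U.length := by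
    obtain ⟨b, hb, hbe⟩ := hbq
    have hbq' : b ≠ q := by
      rintro rfl
      exact dL₂ b hb hqmem
    obtain ⟨PB, hPB, hPBb, hPBq, hPBsub, hPBlen⟩ :=
      IsPathList.exists_isPathList_through (L := (q :: L₂).reverse) (x := y) (p := q) (a := b)
        (IsPathList.reverse ⟨hch4.2.1, hnd4.2.1⟩)
        (by rw [List.head?_reverse, ← hy, hl3, List.getLast?_append_of_ne_nil _ (by simp)])
        (by simp) N₂
        (fun v hv => ⟨by
          have h4 := (h2 v hv).1
          have h5 := hMN v
          have h6 := hN₂L v hv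
          rw [hM] at h6
          simp only [List.mem_append, List.mem_reverse] at h6 ⊢
          tauto, (h2 v hv).2.symm⟩) hq (by simp [hb]) hbq'
    have hsub' : ∀ v ∈ PB, B v := by
      intro v hv
      have := hPBsub v hv
      simp only [List.mem_reverse, List.mem_cons] at this
      exact this.symm
    rcases hbe with ⟨rfl, rfl⟩ | ⟨rfl, rfl⟩
    · have h7 : PB.reverse.head? = some e₁ := by rw [List.head?_reverse]; exact hPBq
      obtain ⟨U, hU⟩ := List.head?_eq_some_iff.1 h7
      refine ⟨U, hU ▸ hPB.reverse, ?_, ?_, ?_⟩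
      · rw [← hU, List.getLast?_reverse]; exact hPBb
      · rw [← hU]; intro v hv; exact hsub' v (List.mem_reverse.1 hv)
      · have := congrArg List.length hU
        simp at this; omega
    · obtain ⟨U, rfl⟩ := List.head?_eq_some_iff.1 hPBb
      exact ⟨U, hPB, hPBq, hsub', by simpa using hPBlen⟩
  have hUnd := List.nodup_cons.1 hU.nodup
  obtain ⟨c1, g1⟩ := isChain_glue hPA.chain hPAp hk.chain₁
  rw [hk.last] at g1
  obtain ⟨c2, g2⟩ := isChain_glue c1 g1 hU.chain
  rw [hUe] at g2
  have hrev : (e₂ :: (T₂.reverse ++ [a])).IsChain G.Adj := by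
    have := isChain_adj_reverse.2 hk.chain₂
    simpa using this
  obtain ⟨c3, g3⟩ := isChain_glue c2 g2 hrev
  have hPAA : ∀ v ∈ PA, A v := by
    intro v hv
    have := hPAsub v hv
    simpa using this
  have hkn1 := List.nodup_cons.1 hkn.1
  have hkn2 := List.nodup_cons.1 hkn.2.1
  have hkn3 := List.nodup_append.1 hkn2.2
  have hlen : N₁.card + N₂.card ≤ (PA ++ T₁ ++ U ++ T₂.reverse).length := by
    simp only [List.length_append]
    omega
  -- The cycle runs from `a` to `p` through `N₁`, along `T₁` to `e₁`, through `N₂` to `e₂`, and back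
  -- along `T₂`. Each joint `p`, `e₁`, `e₂` is listed only as the end of the earlier piece, so an
  -- empty `T₁` (when `p = e₁`) causes no repetition.
  refine ⟨PA ++ T₁ ++ U ++ T₂.reverse, ?_, Or.inr hlen⟩
  refine IsCycleList.of_isChain_append (a := a) (by rw [List.append_assoc]; exact c3) ?_ ?_
    (h3.trans hlen)
  · obtain ⟨PA', rfl⟩ := List.head?_eq_some_iff.1 hPAa
    rfl
  · refine List.nodup_append.2 ⟨List.nodup_append.2 ⟨List.nodup_append.2
      ⟨hPA.nodup, hkn1.2, ?_⟩, hUnd.2, ?_⟩, List.nodup_reverse.2 hkn3.1, ?_⟩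
    · rintro v hv v' hv' rfl
      exact hk.avoid₁ v hv' (hPAA v hv)
    · rintro v hv v' hv' rfl
      have hBv := hUsub v (List.mem_cons_of_mem _ hv')
      rcases List.mem_append.1 hv with hv | hv
      · obtain ⟨rfl, rfl⟩ := hAB v (hPAA v hv) hBv
        rcases hk.ends with ⟨h4, -⟩ | ⟨h4, -⟩
        · exact hUnd.1 (h4 ▸ hv')
        · exact hpe₂ h4.symm
      · have := hk.avoid₃ v (List.mem_cons_of_mem _ hv) hBv
        exact hUnd.1 (this ▸ hv')
    · rintro v hv v' hv' rfl
      rw [List.mem_reverse] at hv'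
      rcases List.mem_append.1 hv with hv | hv
      · rcases List.mem_append.1 hv with hv | hv
        · exact hk.avoid₂ v (List.mem_append_left _ hv') (hPAA v hv)
        · exact hkn.2.2 v (List.mem_cons_of_mem _ hv) v
            (List.mem_cons_of_mem _ (List.mem_append_left _ hv')) rfl
      · exact hk.avoid₄ v (List.mem_cons_of_mem _ hv') (hUsub v (List.mem_cons_of_mem _ hv))

end PosaLemma

/-! ### Kopylov's argument and the degenerate ordering -/

section Core

variable {V : Type u} {G : SimpleGraph V}

/-- Any two distinct nonadjacent vertices are the ends of a path with at least `k` vertices. -/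
def Saturated (k : ℕ) (G : SimpleGraph V) : Prop :=
  ∀ u v, u ≠ v → ¬ G.Adj u v → ∃ l, IsPathList G l ∧ l.head? = some u ∧ l.getLast? = some v ∧
    k ≤ l.length

/-- A long cycle created by the edge `uv` must use it, and the rest of the cycle is the required
path. -/
theorem saturated_of_sup_edge {k : ℕ} (hG : LongCycleFree k G)
    (h : ∀ u v, u ≠ v → ¬ G.Adj u v → ¬ LongCycleFree k (G ⊔ SimpleGraph.edge u v)) :
    Saturated k G := by
  intro u v huv hadj
  have h1 := h u v huv hadj
  have h2 : ¬ ∀ l, IsCycleList (G ⊔ SimpleGraph.edge u v) l → l.length < k :=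
    fun h' => h1 (LongCycleFree.of_isCycleList h')
  push Not at h2
  obtain ⟨l, hl, hkl⟩ := h2
  rcases hl.of_sup_edge with h3 | ⟨q, hq, hperm⟩
  · exact absurd (h3.length_lt hG) (by omega)
  · refine ⟨_, hq, rfl, List.getLast?_concat (l := u :: q), ?_⟩
    rw [hperm.length_eq]; exact hkl

theorem isCycleList_toList {H : Finset V} (hH : 3 ≤ H.card)
    (h : ∀ x ∈ H, ∀ y ∈ H, x ≠ y → G.Adj x y) : IsCycleList G H.toList := by
  refine ⟨by rwa [Finset.length_toList], H.nodup_toList, ?_, ?_⟩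
  · refine (List.Pairwise.imp_of_mem ?_ H.nodup_toList).isChain
    intro a b ha hb hab
    exact h a (Finset.mem_toList.1 ha) b (Finset.mem_toList.1 hb) hab
  · intro a ha b hb
    have ha' := Finset.mem_toList.1 (List.mem_of_getLast? ha)
    have hb' := Finset.mem_toList.1 (List.mem_of_mem_head? hb)
    refine h a ha' b hb' ?_
    rintro rfl
    have hn := H.nodup_toList
    have hlen : 2 ≤ H.toList.length := by rw [Finset.length_toList]; omega
    obtain ⟨l, hl⟩ := List.head?_eq_some_iff.1 hb
    rw [hl] at ha hn hlen
    rcases l with - | ⟨c, l⟩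
    · simp at hlen
    · rw [List.getLast?_cons_cons] at ha
      exact (List.nodup_cons.1 hn).1 (List.mem_of_getLast? ha)

variable [Fintype V]

/-- Kopylov's argument: a family `F` of nonadjacent pairs such that the ends of a pair have many
neighbours, through which one can pass to other pairs of the family, is empty. -/
theorem Saturated.not_pair {k : ℕ} (hk : 3 ≤ k) (hS : Saturated k G) (hU : Unseparated G)
    (hG : LongCycleFree k G) (F : V → V → Prop) (N₁ N₂ : V → Finset V)
    (hF : ∀ x y, F x y → x ≠ y ∧ ¬ G.Adj x y)
    (h1 : ∀ x y, F x y → ∀ z ∈ N₁ x, G.Adj x z ∧ (¬ G.Adj z y → F z y))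
    (h2 : ∀ x y, F x y → ∀ z ∈ N₂ y, G.Adj y z ∧ (¬ G.Adj x z → F x z))
    (h3 : ∀ x y, F x y → (N₁ x).Nonempty ∧ (N₂ y).Nonempty ∧ k ≤ (N₁ x).card + (N₂ y).card)
    (x y : V) : ¬ F x y := by
  classical
  -- This replaces the choice of a longest path joining a pair of `F`: fewer than `n` vertices lie
  -- off the path. A chosen neighbour off the path either closes a long cycle or gives another pair
  -- of `F` with a longer path.
  have main : ∀ n : ℕ, ∀ x y l, F x y → IsPathList G l → l.head? = some x → l.getLast? = some y →
      k ≤ l.length → ¬ Fintype.card V < l.length + n := by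
    intro n
    induction n with
    | zero =>
      intro x y l _ hl _ _ _ hn
      exact absurd hl.nodup.length_le_card (by omega)
    | succ n ih =>
      intro x y l hxy hl hx hy hkl hn
      by_cases hN₁ : ∀ z ∈ N₁ x, z ∈ l
      · by_cases hN₂ : ∀ z ∈ N₂ y, z ∈ l
        · obtain ⟨h4, h5, h6⟩ := h3 x y hxy
          obtain ⟨m, hm, hml⟩ := hU.exists_isCycleList hl (by omega) hx hy (N₁ x) (N₂ y)
            (fun z hz => ⟨hN₁ z hz, (h1 x y hxy z hz).1⟩)
            (fun z hz => ⟨hN₂ z hz, (h2 x y hxy z hz).1.symm⟩) h4 h5 (by omega)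
          have := hm.length_lt hG
          omega
        · push Not at hN₂
          obtain ⟨z, hz, hzl⟩ := hN₂
          obtain ⟨h4, h5⟩ := h2 x y hxy z hz
          have hpath : IsPathList G (l ++ [z]) := by
            refine ⟨List.isChain_append.2 ⟨hl.chain, List.isChain_singleton _, ?_⟩, ?_⟩
            · intro a ha b hb
              rw [hy] at ha
              simp at ha hb
              subst ha hb
              exact h4
            · exact List.nodup_append.2 ⟨hl.nodup, by simp, fun a ha b hb => by
                simp at hb; rintro rfl; exact hzl (hb ▸ ha)⟩
          have hhead : (l ++ [z]).head? = some x := by rw [List.head?_append, hx]; rfl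
          by_cases hxz : G.Adj x z
          · have : IsCycleList G (l ++ [z]) := ⟨by simp; omega, hpath.nodup, hpath.chain, by
              intro a ha b hb
              rw [hhead] at hb
              simp at ha hb
              subst ha hb
              exact hxz.symm⟩
            have := this.length_lt hG
            simp at this; omega
          · exact ih x z (l ++ [z]) (h5 hxz) hpath hhead (by simp) (by simp; omega) (by simp; omega)
      · push Not at hN₁
        obtain ⟨z, hz, hzl⟩ := hN₁
        obtain ⟨h4, h5⟩ := h1 x y hxy z hz
        obtain ⟨l', rfl⟩ := List.head?_eq_some_iff.1 hx
        have hpath : IsPathList G (z :: x :: l') :=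
          ⟨List.isChain_cons_cons.2 ⟨h4.symm, hl.chain⟩, List.nodup_cons.2 ⟨hzl, hl.nodup⟩⟩
        have hlast : (z :: x :: l').getLast? = some y := by rw [List.getLast?_cons_cons]; exact hy
        by_cases hzy : G.Adj z y
        · have : IsCycleList G (z :: x :: l') :=
            ⟨by simp at hkl ⊢; omega, hpath.nodup, hpath.chain, by
              intro a ha b hb
              rw [hlast] at ha
              simp at ha hb
              subst ha hb
              exact hzy.symm⟩
          have := this.length_lt hG
          simp at this hkl; omega
        · exact ih z y _ (h5 hzy) hpath rfl hlast (by simp at hkl ⊢; omega)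
            (by simp at hn ⊢; omega)
  intro hxy
  obtain ⟨l, hl, hx, hy, hkl⟩ := hS x y (hF x y hxy).1 (hF x y hxy).2
  exact main (Fintype.card V + 1) x y l hxy hl hx hy hkl (by omega)

theorem TwoConnected.exists_adj_ne (h : TwoConnected G) (v u : V) :
    ∃ w, G.Adj v w ∧ w ≠ u := by
  classical
  have hcard : 3 ≤ Fintype.card V := by
    have := h.1; rwa [Nat.card_eq_fintype_card] at this
  have key : ∀ u, u ≠ v → ∃ w, G.Adj v w ∧ w ≠ u := by
    intro u huv
    obtain ⟨w, hw⟩ : ∃ w, w ∉ ({u, v} : Finset V) := by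
      by_contra hcon
      push Not at hcon
      have := Finset.card_le_card (fun x _ => hcon x : (Finset.univ : Finset V) ⊆ {u, v})
      rw [Finset.card_univ] at this
      have := Finset.card_le_two (a := u) (b := v)
      omega
    simp only [Finset.mem_insert, Finset.mem_singleton, not_or] at hw
    obtain ⟨l, h1, -, h3, h4, h5⟩ := h.unseparated u v w huv.symm hw.1
    obtain ⟨l, rfl⟩ := List.head?_eq_some_iff.1 h3
    rcases l with - | ⟨z, l⟩
    · simp at h4; exact absurd h4.symm hw.2
    · refine ⟨z, (List.isChain_cons_cons.1 h1).1, ?_⟩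
      rintro rfl
      exact h5 (by simp)
  by_cases huv : u = v
  · subst huv
    have : Nontrivial V := Fintype.one_lt_card_iff_nontrivial.1 (by omega)
    obtain ⟨w, hw⟩ := exists_ne u
    obtain ⟨z, hz, -⟩ := key w hw
    exact ⟨z, hz, hz.ne'⟩
  · exact key u huv

open Classical in
/-- A saturated 2-connected graph without cycles of length at least `k` can be reduced to the empty
set or to a set of `k - s` vertices by removing successively vertices of degree at most `s`. -/
theorem Saturated.exists_degenerate {k : ℕ} (hk : 5 ≤ k) (hkn : k ≤ Fintype.card V)
    (hS : Saturated k G) (h2 : TwoConnected G) (hG : LongCycleFree k G) :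
    ∃ (s : ℕ) (A : Finset V), 2 ≤ s ∧ s ≤ (k - 1) / 2 ∧ A.card ≤ k - s ∧
      ∀ S, A ⊂ S → ∃ v ∈ S, v ∉ A ∧ (S.filter (G.Adj v)).card ≤ s := by
  set t := (k - 1) / 2 with ht
  have hU := h2.unseparated
  -- Two vertices of a core have degree sum at least `2t + 2 ≥ k` within it, so `Saturated.not_pair`
  -- makes every core a clique. A core of maximum size is used.
  let core : Finset V → Prop := fun H => ∀ v ∈ H, t + 1 ≤ (H.filter (G.Adj v)).card
  obtain ⟨H, hH, hmax⟩ := Finset.exists_max_image (Finset.univ.filter core) Finset.card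
    ⟨∅, by simp [core]⟩
  have hcore : core H := (Finset.mem_filter.1 hH).2
  have hmax' : ∀ S, core S → S.card ≤ H.card := fun S hS => hmax S (by simp [hS])
  have hclique : ∀ x ∈ H, ∀ y ∈ H, x ≠ y → G.Adj x y := by
    intro x hx y hy hxy
    by_contra hadj
    refine hS.not_pair (by omega) hU hG (fun x y => x ∈ H ∧ y ∈ H ∧ x ≠ y ∧ ¬ G.Adj x y)
      (fun v => H.filter (G.Adj v)) (fun v => H.filter (G.Adj v)) (fun x y h => h.2.2)
      ?_ ?_ ?_ x y ⟨hx, hy, hxy, hadj⟩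
    · rintro x y ⟨hx, hy, hxy, hadj⟩ z hz
      rw [Finset.mem_filter] at hz
      refine ⟨hz.2, fun h' => ⟨hz.1, hy, ?_, h'⟩⟩
      rintro rfl; exact hadj hz.2
    · rintro x y ⟨hx, hy, hxy, hadj⟩ z hz
      rw [Finset.mem_filter] at hz
      refine ⟨hz.2, fun h' => ⟨hx, hz.1, ?_, h'⟩⟩
      rintro rfl; exact hadj hz.2.symm
    · rintro x y ⟨hx, hy, hxy, hadj⟩
      have h3 := hcore x hx
      have h4 := hcore y hy
      refine ⟨Finset.card_pos.1 (by omega), Finset.card_pos.1 (by omega), by omega⟩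
  rcases H.eq_empty_or_nonempty with hHe | ⟨v₀, hv₀⟩
  · refine ⟨t, ∅, by omega, le_rfl, by simp, fun S hS => ?_⟩
    by_contra hcon
    push Not at hcon
    have : core S := fun v hv => hcon v hv (by simp)
    have := hmax' S this
    rw [hHe] at this
    have := Finset.card_lt_card hS
    omega
  have hdeg : ∀ x ∈ H, (H.filter (G.Adj x)).card + 1 = H.card := by
    intro x hx
    have : H.filter (G.Adj x) = H.erase x := by
      ext y
      simp only [Finset.mem_filter, Finset.mem_erase]
      constructor
      · rintro ⟨h3, h4⟩; exact ⟨h4.ne', h3⟩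
      · rintro ⟨h3, h4⟩; exact ⟨h4, hclique x hx y h4 h3.symm⟩
    rw [this]
    exact Finset.card_erase_add_one hx
  have hr : t + 2 ≤ H.card := by
    have := hdeg v₀ hv₀
    have := hcore v₀ hv₀
    omega
  have hrk : H.card < k := by
    have hcyc := isCycleList_toList (by omega) hclique
    have := hcyc.length_lt hG
    rwa [Finset.length_toList] at this
  -- Otherwise every vertex of `S \ H` has more than `k - H.card` neighbours in `S`. With the
  -- `H.card - 1` neighbours of a vertex of `H` inside `H` this makes `k`, so all pairs between `H`
  -- and `S \ H` are adjacent and `H` plus one vertex is a larger core.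
  have key : ∀ S, H ⊂ S → ∃ v ∈ S, v ∉ H ∧ (S.filter (G.Adj v)).card ≤ k - H.card := by
    intro S hHS
    by_contra hcon
    push Not at hcon
    obtain ⟨y, hyS, hyH⟩ := Finset.exists_of_ssubset hHS
    have hadj : ∀ x ∈ H, G.Adj x y := by
      intro x hx
      by_contra hadj
      refine hS.not_pair (by omega) hU hG (fun x y => x ∈ H ∧ y ∈ S ∧ x ≠ y ∧ ¬ G.Adj x y)
        (fun v => H.filter (G.Adj v)) (fun v => S.filter (G.Adj v)) (fun x y h => h.2.2)
        ?_ ?_ ?_ x y ⟨hx, hyS, by rintro rfl; exact hyH hx, hadj⟩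
      · rintro x y ⟨hx, hy, hxy, hadj⟩ z hz
        rw [Finset.mem_filter] at hz
        refine ⟨hz.2, fun h' => ⟨hz.1, hy, ?_, h'⟩⟩
        rintro rfl; exact hadj hz.2
      · rintro x y ⟨hx, hy, hxy, hadj⟩ z hz
        rw [Finset.mem_filter] at hz
        refine ⟨hz.2, fun h' => ⟨hx, hz.1, ?_, h'⟩⟩
        rintro rfl; exact hadj hz.2.symm
      · rintro x y ⟨hx, hy, hxy, hadj⟩
        have hyH : y ∉ H := fun h' => hadj (hclique x hx y h' hxy)
        have h3 := hdeg x hx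
        have h4 := hcon y hy hyH
        refine ⟨Finset.card_pos.1 (by omega), Finset.card_pos.1 (by omega), by omega⟩
    have : core (insert y H) := by
      intro v hv
      rcases Finset.mem_insert.1 hv with rfl | hv
      · have : H ⊆ (insert v H).filter (G.Adj v) := fun x hx => by
          simp [hx, (hadj x hx).symm]
        have := Finset.card_le_card this
        omega
      · exact (hcore v hv).trans (Finset.card_le_card
          (Finset.filter_subset_filter _ (Finset.subset_insert _ _)))
    have := hmax' _ this
    rw [Finset.card_insert_of_notMem hyH] at this
    omega
  -- The upper bound on `s` comes from `t + 2 ≤ H.card`. For `2 ≤ s`, apply `key` to the whole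
  -- vertex set: some degree is at most `s`, and degrees in a 2-connected graph are at least 2.
  refine ⟨k - H.card, H, ?_, by omega, by omega, key⟩
  by_contra hs
  have hne : H ≠ Finset.univ := by
    intro h'
    have : H.card = Fintype.card V := by rw [h', Finset.card_univ]
    omega
  obtain ⟨v, -, -, hv⟩ := key Finset.univ (Finset.ssubset_univ_iff.2 hne)
  obtain ⟨w, hw, -⟩ := h2.exists_adj_ne v v
  obtain ⟨z, hz, hzw⟩ := h2.exists_adj_ne v w
  have : ({w, z} : Finset V) ⊆ Finset.univ.filter (G.Adj v) := by
    intro a ha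
    simp at ha ⊢
    rcases ha with rfl | rfl <;> assumption
  have := Finset.card_le_card this
  rw [Finset.card_pair hzw.symm] at this
  omega

-- Reverse the removal order: `A` takes the first positions, and the vertex removed from a set `S`
-- takes position `S.card - 1`, so its earlier neighbours are its neighbours in `S`.
open Classical in
theorem exists_rank {s : ℕ} {A : Finset V}
    (h : ∀ S, A ⊂ S → ∃ v ∈ S, v ∉ A ∧ (S.filter (G.Adj v)).card ≤ s) :
    ∃ ρ : V → ℕ, Function.Injective ρ ∧ (∀ v, ρ v < Fintype.card V) ∧
      ∀ v, A.card ≤ ρ v → (Finset.univ.filter fun w => G.Adj v w ∧ ρ w < ρ v).card ≤ s := by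
  have main : ∀ (n : ℕ) (S : Finset V), A ⊆ S → S.card = A.card + n → ∃ ρ : V → ℕ,
      Set.InjOn ρ S ∧ (∀ v ∈ S, ρ v < S.card) ∧
      ∀ v ∈ S, A.card ≤ ρ v → (S.filter fun w => G.Adj v w ∧ ρ w < ρ v).card ≤ s := by
    intro n
    induction n with
    | zero =>
      intro S hAS hcard
      obtain rfl := Finset.eq_of_subset_of_card_le hAS (by omega)
      refine ⟨fun v => if hv : v ∈ A then (A.equivFin ⟨v, hv⟩ : ℕ) else 0, ?_, ?_, ?_⟩
      · intro v hv w hw hvw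
        have hv' : v ∈ A := hv
        have hw' : w ∈ A := hw
        simp only [hv', hw', dif_pos] at hvw
        have := A.equivFin.injective (Fin.ext hvw)
        simpa using this
      · intro v hv
        simp only [hv, dif_pos]
        exact Fin.is_lt _
      · intro v hv hcon
        simp only [hv, dif_pos] at hcon
        exact absurd (Fin.is_lt (A.equivFin ⟨v, hv⟩)) (by omega)
    | succ n ih =>
      intro S hAS hcard
      obtain ⟨v, hvS, hvA, hv⟩ := h S (hAS.ssubset_of_ne (by rintro rfl; omega))
      have hce := Finset.card_erase_add_one hvS
      obtain ⟨ρ, h1, h2, h3⟩ := ih (S.erase v) (Finset.subset_erase.2 ⟨hAS, hvA⟩) (by omega)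
      have hup : ∀ w ∈ S, w ≠ v → Function.update ρ v (S.card - 1) w = ρ w ∧ ρ w < S.card - 1 :=
        fun w hw hwv => ⟨Function.update_of_ne hwv _ _, by
          have := h2 w (Finset.mem_erase.2 ⟨hwv, hw⟩); omega⟩
      have hupv : Function.update ρ v (S.card - 1) v = S.card - 1 := Function.update_self ..
      refine ⟨Function.update ρ v (S.card - 1), ?_, ?_, ?_⟩
      · intro a ha b hb hab
        by_cases hav : a = v <;> by_cases hbv : b = v
        · rw [hav, hbv]
        · subst hav
          have := hup b hb hbv
          omega
        · subst hbv
          have := hup a ha hav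
          omega
        · refine h1 (Finset.mem_erase.2 ⟨hav, ha⟩) (Finset.mem_erase.2 ⟨hbv, hb⟩) ?_
          rw [← (hup a ha hav).1, ← (hup b hb hbv).1, hab]
      · intro w hw
        by_cases hwv : w = v
        · subst hwv; omega
        · have := hup w hw hwv; omega
      · intro w hw hle
        by_cases hwv : w = v
        · subst hwv
          refine le_trans (Finset.card_le_card ?_) hv
          intro a ha
          rw [Finset.mem_filter] at ha ⊢
          exact ⟨ha.1, ha.2.1⟩
        · have hw' := hup w hw hwv
          refine le_trans (Finset.card_le_card ?_) (h3 w (Finset.mem_erase.2 ⟨hwv, hw⟩) (by omega))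
          intro a ha
          rw [Finset.mem_filter] at ha ⊢
          by_cases hav : a = v
          · subst hav; omega
          · have := hup a ha.1 hav
            exact ⟨Finset.mem_erase.2 ⟨hav, ha.1⟩, ha.2.1, by omega⟩
  obtain ⟨ρ, h1, h2, h3⟩ := main (Fintype.card V - A.card) Finset.univ (Finset.subset_univ _) (by
    have := Finset.card_le_univ A
    rw [Finset.card_univ]; omega)
  exact ⟨ρ, fun a b hab => h1 (by simp) (by simp) hab, fun v => by simpa using h2 v (by simp),
    fun v hv => h3 v (by simp) hv⟩

end Core

/-! ### Kelmans operations that compress the sets of earlier neighbours -/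

section Compression

variable {V : Type u} {G : SimpleGraph V}

theorem Feasible.lt_of_lt {P : GraphParameter.{u}} (hP : Feasible P) [Finite V]
    {G G' : SimpleGraph V} (hG : G.Connected) (h : G < G') : P V G < P V G' := by
  induction G using WellFoundedGT.induction with
  | ind G ih =>
    obtain ⟨x, y, hxy, hxy'⟩ : ∃ x y, G'.Adj x y ∧ ¬ G.Adj x y := by
      by_contra hcon
      push Not at hcon
      exact h.not_ge fun x y => hcon x y
    have h1 := hP.lt_addEdge V G hG x y hxy.ne hxy'
    have hlt : G < G ⊔ SimpleGraph.edge x y := by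
      refine lt_of_le_of_ne le_sup_left fun he => hxy' ?_
      rw [he, SimpleGraph.sup_adj, SimpleGraph.edge_adj]
      exact Or.inr ⟨Or.inl ⟨rfl, rfl⟩, hxy.ne⟩
    have hle : G ⊔ SimpleGraph.edge x y ≤ G' := by
      refine sup_le h.le fun a b hab => ?_
      rw [SimpleGraph.edge_adj] at hab
      rcases hab.1 with ⟨rfl, rfl⟩ | ⟨rfl, rfl⟩
      · exact hxy
      · exact hxy.symm
    rcases hle.eq_or_lt with h2 | h2
    · rwa [h2] at h1
    · exact h1.trans (ih _ hlt (hG.mono hlt.le) h2)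

theorem kelmans_adj {x y a b : V} : (kelmans G x y).Adj a b ↔ a ≠ b ∧
    (G.Adj a b ∧ (¬ ∃ w, (G.Adj x w ∧ w ≠ y ∧ ¬ G.Adj y w) ∧ s(a, b) = s(w, x)) ∨
      ∃ w, (G.Adj x w ∧ w ≠ y ∧ ¬ G.Adj y w) ∧ s(a, b) = s(w, y)) := by
  simp only [kelmans, SimpleGraph.fromEdgeSet_adj, Set.mem_union, Set.mem_sdiff,
    SimpleGraph.mem_edgeSet, Set.mem_ofPred_eq, Set.mem_insert_iff, SimpleGraph.mem_neighborSet,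
    not_or]
  tauto

/-- The vertices of `S` are joined to everything, and the first `r` vertices form a clique. -/
def shifted (ρ : V → ℕ) (r : ℕ) (S : Finset V) : SimpleGraph V where
  Adj u v := u ≠ v ∧ (u ∈ S ∨ v ∈ S ∨ ρ u < r ∧ ρ v < r)
  symm := ⟨fun u v h => ⟨h.1.symm, by tauto⟩⟩
  loopless := ⟨fun u h => h.1 rfl⟩

theorem shifted_adj {ρ : V → ℕ} {r : ℕ} {S : Finset V} {u v : V} :
    (shifted ρ r S).Adj u v ↔ u ≠ v ∧ (u ∈ S ∨ v ∈ S ∨ ρ u < r ∧ ρ v < r) := Iff.rfl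

open Classical in
/-- The Kelmans operation from `b` to `u` when all vertices that change their neighbourhoods come
later than `b` and `u`. -/
theorem kelmans_adj_of_lt {ρ : V → ℕ} {b u : V}
    (hM : ∀ m, G.Adj b m → m ≠ u → ¬ G.Adj u m → ρ b < ρ m ∧ ρ u < ρ m) {a c : V}
    (hca : ρ c < ρ a) : (kelmans G b u).Adj a c ↔
      if G.Adj b a ∧ a ≠ u ∧ ¬ G.Adj u a then c = u ∨ (c ≠ b ∧ G.Adj a c) else G.Adj a c := by
  have hac : a ≠ c := by rintro rfl; omega
  rw [kelmans_adj]
  have h1 : (∃ w, (G.Adj b w ∧ w ≠ u ∧ ¬ G.Adj u w) ∧ s(a, c) = s(w, b)) ↔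
      (G.Adj b a ∧ a ≠ u ∧ ¬ G.Adj u a) ∧ c = b := by
    constructor
    · rintro ⟨w, hw, he⟩
      have := hM w hw.1 hw.2.1 hw.2.2
      rw [Sym2.eq_iff] at he
      rcases he with ⟨rfl, rfl⟩ | ⟨rfl, rfl⟩
      · exact ⟨hw, rfl⟩
      · omega
    · rintro ⟨h, rfl⟩
      exact ⟨a, h, rfl⟩
  have h2 : (∃ w, (G.Adj b w ∧ w ≠ u ∧ ¬ G.Adj u w) ∧ s(a, c) = s(w, u)) ↔
      (G.Adj b a ∧ a ≠ u ∧ ¬ G.Adj u a) ∧ c = u := by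
    constructor
    · rintro ⟨w, hw, he⟩
      have := hM w hw.1 hw.2.1 hw.2.2
      rw [Sym2.eq_iff] at he
      rcases he with ⟨rfl, rfl⟩ | ⟨rfl, rfl⟩
      · exact ⟨hw, rfl⟩
      · omega
    · rintro ⟨h, rfl⟩
      exact ⟨a, h, rfl⟩
  rw [h1, h2]
  split_ifs with h
  · simp only [h, true_and]
    tauto
  · simp only [h, false_and]
    tauto

variable [Fintype V]

open Classical in
/-- The neighbours of `v` that come before `v` in the order given by `ρ`. -/
noncomputable def back (G : SimpleGraph V) (ρ : V → ℕ) (v : V) : Finset V :=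
  Finset.univ.filter fun w => G.Adj v w ∧ ρ w < ρ v

theorem mem_back {ρ : V → ℕ} {v w : V} : w ∈ back G ρ v ↔ G.Adj v w ∧ ρ w < ρ v := by
  simp [back]

/-- The first `r` vertices form a clique, and every later vertex is joined to exactly `s` earlier
vertices. -/
structure Built (G : SimpleGraph V) (ρ : V → ℕ) (r s : ℕ) : Prop where
  clique : ∀ u v, u ≠ v → ρ u < r → ρ v < r → G.Adj u v
  card_back : ∀ v, r ≤ ρ v → (back G ρ v).card = s

theorem card_rank_lt {ρ : V → ℕ} (hρ : Function.Injective ρ) (hlt : ∀ v, ρ v < Fintype.card V)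
    {m : ℕ} (hm : m ≤ Fintype.card V) : (Finset.univ.filter fun w => ρ w < m).card = m := by
  have hsurj : ∀ i < Fintype.card V, ∃ v, ρ v = i := by
    have : Function.Bijective (fun v => (⟨ρ v, hlt v⟩ : Fin (Fintype.card V))) := by
      rw [Fintype.bijective_iff_injective_and_card]
      exact ⟨fun a b hab => hρ (by simpa using hab), by simp⟩
    intro i hi
    obtain ⟨v, hv⟩ := this.2 ⟨i, hi⟩
    exact ⟨v, by simpa using hv⟩
  have : (Finset.univ.filter fun w => ρ w < m).image ρ = Finset.range m := by
    ext i
    simp only [Finset.mem_image, Finset.mem_filter, Finset.mem_univ, true_and, Finset.mem_range]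
    constructor
    · rintro ⟨v, hv, rfl⟩; exact hv
    · intro hi
      obtain ⟨v, rfl⟩ := hsurj i (by omega)
      exact ⟨v, hi, rfl⟩
  rw [← Finset.card_image_of_injective _ hρ, this, Finset.card_range]

/-- The sets of earlier neighbours can be enlarged to size `s` independently of each other; there is
room because at least `r ≥ s` vertices precede each late vertex. -/
theorem exists_built {ρ : V → ℕ} (hρ : Function.Injective ρ) (hlt : ∀ v, ρ v < Fintype.card V)
    {r s : ℕ} (hsr : s ≤ r) (h : ∀ v, r ≤ ρ v → (back G ρ v).card ≤ s) :
    ∃ G', G ≤ G' ∧ Built G' ρ r s := by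
  classical
  have hex : ∀ v, ∃ B : Finset V, r ≤ ρ v →
      back G ρ v ⊆ B ∧ B ⊆ Finset.univ.filter (fun w => ρ w < ρ v) ∧ B.card = s := by
    intro v
    by_cases hv : r ≤ ρ v
    · obtain ⟨B, h1, h2, h3⟩ := Finset.exists_subsuperset_card_eq (s := back G ρ v)
        (t := Finset.univ.filter (fun w => ρ w < ρ v)) (n := s)
        (fun w hw => by simpa using (mem_back.1 hw).2) (h v hv)
        (by rw [card_rank_lt hρ hlt (hlt v).le]; omega)
      exact ⟨B, fun _ => ⟨h1, h2, h3⟩⟩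
    · exact ⟨∅, fun h' => absurd h' hv⟩
  choose B hB using hex
  let G' : SimpleGraph V := 
    { Adj := fun u v => u ≠ v ∧ ((ρ u < r ∧ ρ v < r) ∨ (r ≤ ρ v ∧ u ∈ B v) ∨ (r ≤ ρ u ∧ v ∈ B u))
      symm := ⟨fun u v h => ⟨h.1.symm, by tauto⟩⟩
      loopless := ⟨fun u h => h.1 rfl⟩ }
  have hBlt : ∀ v w, r ≤ ρ v → w ∈ B v → ρ w < ρ v := fun v w hv hw => by
    simpa using (hB v hv).2.1 hw
  refine ⟨G', ?_, ?_, ?_⟩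
  · intro u v huv
    refine ⟨huv.ne, ?_⟩
    rcases lt_trichotomy (ρ u) (ρ v) with h1 | h1 | h1
    · by_cases hv : r ≤ ρ v
      · exact Or.inr (Or.inl ⟨hv, (hB v hv).1 (mem_back.2 ⟨huv.symm, h1⟩)⟩)
      · exact Or.inl (by omega)
    · exact absurd (hρ h1) huv.ne
    · by_cases hu : r ≤ ρ u
      · exact Or.inr (Or.inr ⟨hu, (hB u hu).1 (mem_back.2 ⟨huv, h1⟩)⟩)
      · exact Or.inl (by omega)
  · exact fun u v huv hu hv => ⟨huv, Or.inl ⟨hu, hv⟩⟩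
  · intro v hv
    rw [← (hB v hv).2.2]
    congr 1
    ext w
    rw [mem_back]
    constructor
    · rintro ⟨⟨h1, h2⟩, h3⟩
      rcases h2 with h2 | h2 | h2
      · omega
      · have := hBlt w v h2.1 h2.2; omega
      · exact h2.2
    · intro hw
      have := hBlt v w hv hw
      exact ⟨⟨by rintro rfl; omega, Or.inr (Or.inr ⟨hv, hw⟩)⟩, this⟩

theorem Built.connected {ρ : V → ℕ} {r s : ℕ} (hs : 1 ≤ s)
    (h : Built G ρ r s) {v₀ : V} (hv₀ : ρ v₀ < r) : G.Connected := by
  have key : ∀ n v, ρ v = n → G.Reachable v v₀ := by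
    intro n
    induction n using Nat.strong_induction_on with
    | _ n ih =>
      intro v hv
      by_cases hvr : ρ v < r
      · by_cases hvv : v = v₀
        · rw [hvv]
        · exact (h.clique v v₀ hvv hvr hv₀).reachable
      · have := h.card_back v (by omega)
        obtain ⟨w, hw⟩ := Finset.card_pos.1 (by omega : 0 < (back G ρ v).card)
        rw [mem_back] at hw
        exact hw.1.reachable.trans (ih (ρ w) (by omega) w rfl)
  have : Nonempty V := ⟨v₀⟩
  exact ⟨fun a b => (key _ a rfl).trans (key _ b rfl).symm⟩

theorem Built.eq_shifted {ρ : V → ℕ} (hρ : Function.Injective ρ) {r s : ℕ} {S : Finset V}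
    (h : Built G ρ r s) (hS : ∀ v ∈ S, ρ v < r) (hback : ∀ v, r ≤ ρ v → back G ρ v = S) :
    G = shifted ρ r S := by
  have key : ∀ u v, ρ u < ρ v → (G.Adj u v ↔ (shifted ρ r S).Adj u v) := by
    intro u v huv
    have hne : u ≠ v := by rintro rfl; omega
    rw [shifted_adj]
    by_cases hv : r ≤ ρ v
    · have h1 : u ∈ back G ρ v ↔ G.Adj v u ∧ ρ u < ρ v := mem_back
      rw [hback v hv] at h1
      have h2 : v ∉ S := fun h' => by have := hS v h'; omega
      have h3 : ¬ ρ v < r := by omega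
      rw [G.adj_comm u v]
      tauto
    · have := h.clique u v hne (by omega) (by omega)
      simp only [this, true_iff]
      exact ⟨hne, by omega⟩
  ext u v
  rcases lt_trichotomy (ρ u) (ρ v) with h1 | h1 | h1
  · exact key u v h1
  · rw [hρ h1]; simp
  · rw [G.adj_comm, (shifted ρ r S).adj_comm]; exact key v u h1

-- Since `u` is joined to everything before `w`, a vertex adjacent to `b` but not to `u` cannot
-- precede `w`. Hence the operation leaves the initial clique alone and only exchanges `b` for `u`
-- in some sets of earlier neighbours, whose sizes persist.
open Classical in
theorem Built.kelmans {ρ : V → ℕ} {r s : ℕ} (hr : Built G ρ r s) {b u w : V}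
    (hw : r ≤ ρ w) (hu : ρ u < r) (hb : ρ b < ρ w)
    (huadj : ∀ v, ρ v < ρ w → v ≠ u → G.Adj u v) :
    Built (kelmans G b u) ρ r s ∧ ∀ v, r ≤ ρ v → back (kelmans G b u) ρ v =
      if b ∈ back G ρ v ∧ u ∉ back G ρ v then insert u ((back G ρ v).erase b) else back G ρ v := by
  have hM' : ∀ m, G.Adj b m → m ≠ u → ¬ G.Adj u m → ρ w ≤ ρ m := by
    intro m h1 h2 h3
    by_contra hcon
    exact h3 (huadj m (by omega) h2)
  have hM : ∀ m, G.Adj b m → m ≠ u → ¬ G.Adj u m → ρ b < ρ m ∧ ρ u < ρ m := by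
    intro m h1 h2 h3
    have := hM' m h1 h2 h3
    omega
  have hcond : ∀ v, r ≤ ρ v → ((G.Adj b v ∧ v ≠ u ∧ ¬ G.Adj u v) ↔
      b ∈ back G ρ v ∧ u ∉ back G ρ v) := by
    intro v hv
    rw [mem_back, mem_back, G.adj_comm v b, G.adj_comm v u]
    constructor
    · rintro ⟨h1, h2, h3⟩
      exact ⟨⟨h1, (hM v h1 h2 h3).1⟩, fun h' => h3 h'.1⟩
    · rintro ⟨⟨h1, h2⟩, h3⟩
      exact ⟨h1, by rintro rfl; omega, fun h' => h3 ⟨h', by omega⟩⟩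
  have hback : ∀ v, r ≤ ρ v → back (KelmansExtremal.kelmans G b u) ρ v =
      if b ∈ back G ρ v ∧ u ∉ back G ρ v then insert u ((back G ρ v).erase b) else back G ρ v := by
    intro v hv
    ext c
    by_cases hc : ρ c < ρ v
    · rw [mem_back, kelmans_adj_of_lt hM hc, if_congr (hcond v hv) rfl rfl]
      split_ifs with h
      · simp only [hc, and_true, Finset.mem_insert, Finset.mem_erase, mem_back]
      · simp only [hc, and_true, mem_back]
    · have h1 : c ∉ back (KelmansExtremal.kelmans G b u) ρ v := fun h' => hc (mem_back.1 h').2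
      have h2 : c ∉ back G ρ v := fun h' => hc (mem_back.1 h').2
      have h3 : c ≠ u := by rintro rfl; omega
      simp only [h1, false_iff]
      split_ifs <;> simp [h2, h3]
  refine ⟨⟨?_, ?_⟩, hback⟩
  · have key : ∀ x y, ρ x < ρ y → ρ y < r → (KelmansExtremal.kelmans G b u).Adj y x := by
      intro x y hxy hy
      have hne : y ≠ x := by rintro rfl; omega
      rw [kelmans_adj_of_lt hM hxy, if_neg]
      · exact hr.clique y x hne hy (by omega)
      · rintro ⟨h1, h2, h3⟩
        have := hM' y h1 h2 h3
        omega
    intro x y hxy hx hy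
    rcases lt_trichotomy (ρ x) (ρ y) with h1 | h1 | h1
    · exact (key x y h1 hy).symm
    · by_contra hcon
      rw [kelmans_adj] at hcon
      refine hcon ⟨hxy, Or.inl ⟨hr.clique x y hxy hx hy, ?_⟩⟩
      rintro ⟨m, hm, he⟩
      have := hM' m hm.1 hm.2.1 hm.2.2
      rw [Sym2.eq_iff] at he
      rcases he with ⟨rfl, rfl⟩ | ⟨rfl, rfl⟩ <;> omega
    · exact key y x h1 hx
  · intro v hv
    rw [hback v hv]
    split_ifs with h
    · rw [Finset.card_insert_of_notMem (by simp [h.2]), Finset.card_erase_add_one h.1]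
      exact hr.card_back v hv
    · exact hr.card_back v hv

/-- Let `w` be the first late vertex whose set of earlier neighbours is not `S`; take `b` in that
set outside `S`, and `u ∈ S` missing from it. All late vertices before `w` are joined to `u`, so
`Built.kelmans` applies from `b` to `u`. The total number of earlier neighbours outside `S` drops at
`w` and grows nowhere. -/
theorem Feasible.le_shifted {P : GraphParameter.{u}} (hP : Feasible P) {ρ : V → ℕ}
    (hρ : Function.Injective ρ) {r s : ℕ} (hs : 1 ≤ s) {S : Finset V} (hSr : ∀ v ∈ S, ρ v < r)
    (hSs : S.card = s) : ∀ G : SimpleGraph V, Built G ρ r s → P V G ≤ P V (shifted ρ r S) := by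
  classical
  obtain ⟨v₀, hv₀⟩ := Finset.card_pos.1 (by omega : 0 < S.card)
  have main : ∀ (n : ℕ) (G : SimpleGraph V), Built G ρ r s →
      ∑ v ∈ Finset.univ.filter (fun v => r ≤ ρ v), (back G ρ v \ S).card < n →
      P V G ≤ P V (shifted ρ r S) := by
    intro n
    induction n with
    | zero => intro G _ h; omega
    | succ n ih =>
      intro G hG hn
      by_cases hall : ∀ v, r ≤ ρ v → back G ρ v = S
      · exact (hG.eq_shifted hρ hSr hall) ▸ le_rfl
      push Not at hall
      obtain ⟨w, hw, hmin⟩ := Finset.exists_min_image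
        (Finset.univ.filter fun v => r ≤ ρ v ∧ back G ρ v ≠ S) ρ
        (by obtain ⟨v, hv⟩ := hall; exact ⟨v, by simpa using hv⟩)
      simp only [Finset.mem_filter, Finset.mem_univ, true_and] at hw hmin
      have hcard := hG.card_back w hw.1
      obtain ⟨b, hb, hbS⟩ : ∃ b ∈ back G ρ w, b ∉ S := by
        by_contra hcon
        push Not at hcon
        exact hw.2 (Finset.eq_of_subset_of_card_le hcon (by omega))
      obtain ⟨u, hu, huB⟩ : ∃ u ∈ S, u ∉ back G ρ w := by
        by_contra hcon
        push Not at hcon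
        exact hw.2 (Finset.eq_of_subset_of_card_le hcon (by omega)).symm
      have huadj : ∀ v, ρ v < ρ w → v ≠ u → G.Adj u v := by
        intro v hv hvu
        by_cases hvr : ρ v < r
        · exact hG.clique u v hvu.symm (hSr u hu) hvr
        · have : back G ρ v = S := by
            by_contra hcon
            exact absurd (hmin v ⟨by omega, hcon⟩) (by omega)
          rw [← this, mem_back] at hu
          exact hu.1.symm
      obtain ⟨h1, h2⟩ := hG.kelmans hw.1 (hSr u hu) (mem_back.1 hb).2 huadj
      refine (hP.le_kelmans V G (hG.connected hs (hSr v₀ hv₀)) b u).trans (ih _ h1 ?_)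
      refine lt_of_lt_of_le (Finset.sum_lt_sum (fun v hv => ?_) ⟨w, by simpa using hw.1, ?_⟩)
        (Nat.lt_succ_iff.1 hn)
      · simp only [Finset.mem_filter, Finset.mem_univ, true_and] at hv
        rw [h2 v hv]
        split_ifs with h
        · refine Finset.card_le_card fun x hx => ?_
          simp only [Finset.mem_sdiff, Finset.mem_insert, Finset.mem_erase] at hx ⊢
          rcases hx.1 with rfl | hx'
          · exact absurd hu hx.2
          · exact ⟨hx'.2, hx.2⟩
        · exact le_rfl
      · rw [h2 w hw.1, if_pos ⟨hb, huB⟩]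
        refine Finset.card_lt_card (Finset.ssubset_iff_subset_ne.2 ⟨fun x hx => ?_, fun he => ?_⟩)
        · simp only [Finset.mem_sdiff, Finset.mem_insert, Finset.mem_erase] at hx ⊢
          rcases hx.1 with rfl | hx'
          · exact absurd hu hx.2
          · exact ⟨hx'.2, hx.2⟩
        · have : b ∈ back G ρ w \ S := Finset.mem_sdiff.2 ⟨hb, hbS⟩
          rw [← he] at this
          simp only [Finset.mem_sdiff, Finset.mem_insert, Finset.mem_erase] at this
          rcases this.1 with rfl | h'
          · exact hbS hu
          · exact h'.1 rfl
  exact fun G hG => main _ G hG (Nat.lt_succ_self _)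

end Compression

/-! ### The compressed graph is a competitor -/

section Shifted

variable {V : Type u} {G : SimpleGraph V}

theorem IsCycleList.exists_cons {l : List V} (h : IsCycleList G l) {a : V} (ha : a ∈ l) :
    ∃ m, IsCycleList G (a :: m) ∧ (a :: m).Perm l := by
  obtain ⟨l₁, l₂, rfl⟩ := List.append_of_mem ha
  exact ⟨l₂ ++ l₁, h.append_comm, List.perm_append_comm (l₁ := a :: l₂)⟩

/-- Assign to each element of `I` its predecessor, which lies in `S`. -/
theorem countP_le_of_isChain {R : V → V → Prop} {I S : V → Bool}
    (h : ∀ a b, R a b → I b → S a) (hd : ∀ a, S a → ¬ I a) :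
    ∀ l : List V, l.IsChain R → (∀ a ∈ l.head?, ¬ I a) → l.countP I ≤ l.countP S
  | [], _, _ => by simp
  | [x], _, hx => by
    have : ¬ I x := hx x rfl
    simp [this]
  | x :: y :: l, hl, hx => by
    have hx : ¬ I x := hx x rfl
    rw [List.isChain_cons_cons] at hl
    by_cases hy : I y
    · have hSx := h x y hl.1 hy
      have hSy : ¬ S y := fun h' => hd y h' hy
      have := countP_le_of_isChain h hd l hl.2.tail (by
        intro z hz hIz
        obtain ⟨l', rfl⟩ := List.head?_eq_some_iff.1 hz
        exact hSy (h y z (List.isChain_cons_cons.1 hl.2).1 hIz))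
      simp [hx, hy, hSx, hSy]
      exact this
    · have := countP_le_of_isChain h hd (y :: l) hl.2 (by simpa using hy)
      rw [List.countP_cons_of_neg hx]
      exact this.trans (List.Sublist.countP_le (List.sublist_cons_self _ _))

/-- Besides the predecessors of the elements of `I`, the successor of the last one is a further
element of `S`. -/
theorem countP_lt_of_isChain {R : V → V → Prop} {I S : V → Bool}
    (h : ∀ a b, R a b → I b → S a) (h' : ∀ a b, R a b → I a → S b) (hd : ∀ a, S a → ¬ I a) :
    ∀ l : List V, l.IsChain R → (∀ a ∈ l.head?, ¬ I a) → (∀ a ∈ l.getLast?, ¬ I a) →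
      l.countP I = 0 ∨ l.countP I + 1 ≤ l.countP S
  | [], _, _, _ => by simp
  | [x], _, hx, _ => by
    have : ¬ I x := hx x rfl
    simp [this]
  | [x, y], hl, hx, hy => by
    have : ¬ I x := hx x rfl
    have : ¬ I y := hy y rfl
    simp [*]
  | x :: y :: z :: l, hl, hx, hz => by
    have hx : ¬ I x := hx x rfl
    rw [List.isChain_cons_cons] at hl
    rw [List.getLast?_cons_cons] at hz
    by_cases hy : I y
    · have hSx := h x y hl.1 hy
      have hSy : ¬ S y := fun h' => hd y h' hy
      have hl2 := List.isChain_cons_cons.1 hl.2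
      have hSz := h' y z hl2.1 hy
      have hIz := hd z hSz
      have := countP_lt_of_isChain h h' hd (z :: l) hl2.2 (by simpa using hIz)
        (by rw [← List.getLast?_cons_cons (a := y)]; exact hz)
      have e1 : (x :: y :: z :: l).countP I = (z :: l).countP I + 1 := by
        rw [List.countP_cons_of_neg hx, List.countP_cons_of_pos hy]
      have e2 : (x :: y :: z :: l).countP S = (z :: l).countP S + 1 := by
        rw [List.countP_cons_of_pos hSx, List.countP_cons_of_neg hSy]
      have e3 : 0 < (z :: l).countP S := List.countP_pos_iff.2 ⟨z, by simp, hSz⟩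
      omega
    · have := countP_lt_of_isChain h h' hd (y :: z :: l) hl.2 (by simpa using hy) hz
      have h2 : (y :: z :: l).countP S ≤ (x :: y :: z :: l).countP S :=
        List.Sublist.countP_le (List.sublist_cons_self _ _)
      rw [List.countP_cons_of_neg hx]
      omega

theorem countP_le_card {l : List V} (hl : l.Nodup) {p : V → Bool} {S : Finset V}
    (h : ∀ v ∈ l, p v → v ∈ S) : l.countP p ≤ S.card := by
  classical
  rw [List.countP_eq_length_filter, ← List.toFinset_card_of_nodup (hl.filter p)]
  refine Finset.card_le_card fun v hv => ?_
  simp at hv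
  exact h v hv.1 hv.2

variable [Fintype V]

/-- The late vertices `I` are adjacent only to `S`. A cycle that avoids the rest `K` of the clique
has length at most `2s < k`. Otherwise start it in `K`: it has no late vertex, or fewer late
vertices than vertices of `S`, so its length is at most `k - s`, or at most `(s - 1) + s + (k - 2s)
= k - 1`. -/
theorem shifted_longCycleFree {ρ : V → ℕ} (hρ : Function.Injective ρ)
    (hlt : ∀ v, ρ v < Fintype.card V) {k s : ℕ} (hs : 2 ≤ s) (hsk : 2 * s + 1 ≤ k)
    (hkn : k ≤ Fintype.card V) {S : Finset V} (hS : ∀ v ∈ S, ρ v < k - s) (hSs : S.card = s) :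
    LongCycleFree k (shifted ρ (k - s) S) := by
  classical
  refine LongCycleFree.of_isCycleList fun l hl => ?_
  let I : V → Bool := fun v => decide (k - s ≤ ρ v)
  let S' : V → Bool := fun v => decide (v ∈ S)
  let K : V → Bool := fun v => decide (ρ v < k - s ∧ v ∉ S)
  have hd : ∀ a, S' a → ¬ I a := by
    intro a ha
    have := hS a (by simpa [S'] using ha)
    simp [I]; omega
  have h2 : ∀ a b, (shifted ρ (k - s) S).Adj a b → I b → S' a := by
    intro a b hab hb
    rw [shifted_adj] at hab
    have hb' : k - s ≤ ρ b := by simpa [I] using hb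
    have hbS : b ∉ S := fun h => by have := hS b h; omega
    have : a ∈ S := by
      rcases hab.2 with h | h | h
      · exact h
      · exact absurd h hbS
      · omega
    simpa [S'] using this
  have h1 : ∀ a b, (shifted ρ (k - s) S).Adj a b → I a → S' b := fun a b hab => h2 b a hab.symm
  have hlen : ∀ l : List V, l.length = l.countP I + l.countP S' + l.countP K := by
    have hone : ∀ a, (I a = true ∧ S' a = false ∧ K a = false) ∨
        (I a = false ∧ S' a = true ∧ K a = false) ∨ (I a = false ∧ S' a = false ∧ K a = true) := by
      intro a
      have := hS a
      simp only [I, S', K, decide_eq_true_eq, decide_eq_false_iff_not]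
      by_cases ha : a ∈ S <;> by_cases ha' : ρ a < k - s <;> simp [ha, ha'] <;> first | omega | tauto
    intro l
    induction l with
    | nil => simp
    | cons a l ih =>
      rcases hone a with h | h | h <;> simp [h, ih] <;> omega
  have hcS : l.countP S' ≤ s := hSs ▸ countP_le_card hl.nodup fun v _ h => by simpa [S'] using h
  have hcK : l.countP K ≤ k - s - s := by
    have hsub : S ⊆ Finset.univ.filter fun w => ρ w < k - s := fun v hv => by simpa using hS v hv
    have hcard := Finset.card_sdiff_of_subset hsub
    rw [card_rank_lt hρ hlt (by omega), hSs] at hcard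
    rw [← hcard]
    refine countP_le_card hl.nodup fun v _ h => ?_
    simpa [K] using h
  have hI : l.countP I ≤ l.countP S' := by
    obtain ⟨a, ha, haI⟩ : ∃ a ∈ l, ¬ I a := by
      match l, hl with
      | [], hl => exact absurd hl.three_le (by simp)
      | [a], hl => exact absurd hl.three_le (by simp)
      | a :: b :: l, hl =>
        by_cases ha : I a
        · exact ⟨b, by simp, hd b (h1 a b (List.isChain_cons_cons.1 hl.chain).1 ha)⟩
        · exact ⟨a, by simp, ha⟩
    obtain ⟨m, hm, hperm⟩ := hl.exists_cons ha
    rw [← hperm.countP_eq, ← hperm.countP_eq]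
    exact countP_le_of_isChain h2 hd _ hm.chain (by simpa using haI)
  have := hlen l
  by_cases hK : l.countP K = 0
  · omega
  · obtain ⟨a, ha, haK⟩ := List.countP_pos_iff.1 (Nat.pos_of_ne_zero hK)
    obtain ⟨m, hm, hperm⟩ := hl.exists_cons ha
    have haK' : ρ a < k - s ∧ a ∉ S := by simpa [K] using haK
    have h5 := countP_lt_of_isChain h2 h1 hd _ hm.chain
      (by simp only [List.head?_cons, Option.mem_def, Option.some.injEq, forall_eq', I,
        decide_eq_true_eq]; omega)
      (fun b hb hbI => by
        have h6 := hm.closes b hb a rfl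
        have := h1 b a h6 hbI
        simp [S'] at this
        exact haK'.2 this)
    rw [hperm.countP_eq, hperm.countP_eq] at h5
    omega

theorem shifted_twoConnected {ρ : V → ℕ} {r : ℕ} {S : Finset V} (hS : 2 ≤ S.card)
    (hV : 3 ≤ Fintype.card V) : TwoConnected (shifted ρ r S) := by
  classical
  refine ⟨by rwa [Nat.card_eq_fintype_card], ?_, fun x => ?_⟩
  · obtain ⟨a, ha⟩ := Finset.card_pos.1 (by omega : 0 < S.card)
    have : Nonempty V := ⟨a⟩
    have key : ∀ v, (shifted ρ r S).Reachable v a := fun v => by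
      by_cases hva : v = a
      · rw [hva]
      · exact SimpleGraph.Adj.reachable ⟨hva, Or.inr (Or.inl ha)⟩
    exact ⟨fun u v => (key u).trans (key v).symm⟩
  · obtain ⟨a, ha, hax⟩ := Finset.exists_mem_ne (by omega : 1 < S.card) x
    let a' : ({x}ᶜ : Set V) := ⟨a, by simpa using hax⟩
    have : Nonempty ({x}ᶜ : Set V) := ⟨a'⟩
    have key : ∀ v, ((shifted ρ r S).induce {x}ᶜ).Reachable v a' := fun v => by
      by_cases hva : v = a'
      · rw [hva]
      · refine SimpleGraph.Adj.reachable ?_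
        exact ⟨fun h => hva (Subtype.ext h), Or.inr (Or.inl ha)⟩
    exact ⟨fun u v => (key u).trans (key v).symm⟩

end Shifted

/-! ### The equality case -/

section Uniqueness

variable {V : Type u} {G : SimpleGraph V} [Fintype V]

open Classical in
/-- An application of the closure argument of Ore and Bondy–Chvátal: if a clique `A` is extended by
`s` vertices, each with at least `s` earlier neighbours, and the resulting graph is not
Hamiltonian, then all the new vertices have the same neighbours, which lie in `A`. -/
theorem exists_common_neighbors {k s : ℕ} (hs : 2 ≤ s) (hsk : 2 * s + 1 ≤ k) {ρ : V → ℕ}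
    {A X : Finset V} (hAX : A ⊆ X) (hX : X.card = k) (hA : A.card = k - s)
    (hclique : ∀ x ∈ A, ∀ y ∈ A, x ≠ y → G.Adj x y)
    (hback : ∀ w ∈ X \ A, s ≤ (X.filter fun z => G.Adj w z ∧ ρ z < ρ w).card)
    (hham : ∀ l, IsCycleList G l → l.toFinset ≠ X) :
    ∃ S ⊆ A, S.card = s ∧ ∀ w ∈ X \ A, X.filter (G.Adj w) = S := by
  -- `M` plays the role of the closure: it is edge-maximal without a cycle through exactly `X`, so
  -- nonadjacent vertices of `X` have degree sum less than `k` in `X`.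
  obtain ⟨M, hGM, hM⟩ := (Set.toFinite {H : SimpleGraph V | ∀ l, IsCycleList H l →
    l.toFinset ≠ X}).exists_le_maximal hham
  have hMham : ∀ l, IsCycleList M l → l.toFinset ≠ X := hM.prop
  let d : V → ℕ := fun v => (X.filter (M.Adj v)).card
  have hore : ∀ u ∈ X, ∀ v ∈ X, u ≠ v → k ≤ d u + d v → M.Adj u v := by
    intro u hu v hv huv hd
    by_contra hadj
    have h1 : ¬ ∀ l, IsCycleList (M ⊔ SimpleGraph.edge u v) l → l.toFinset ≠ X := by
      intro h
      have := hM.le_of_ge (y := M ⊔ SimpleGraph.edge u v) h le_sup_left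
      refine hadj (this ?_)
      rw [SimpleGraph.sup_adj, SimpleGraph.edge_adj]
      exact Or.inr ⟨Or.inl ⟨rfl, rfl⟩, huv⟩
    push Not at h1
    obtain ⟨l, hl, hlX⟩ := h1
    rcases hl.of_sup_edge with h2 | ⟨q, hq, hperm⟩
    · exact hMham l h2 hlX
    · have hmem : ∀ z, z ∈ u :: (q ++ [v]) ↔ z ∈ X := fun z => by
        rw [hperm.mem_iff, ← hlX, List.mem_toFinset]
      have hlen : (u :: (q ++ [v])).length = k := by
        rw [hperm.length_eq, ← hX, ← hlX, List.toFinset_card_of_nodup hl.nodup]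
      obtain ⟨m, hm, hsub, hml⟩ := hq.exists_isCycleList_of_cross (by omega) (x := u) (y := v) rfl
        (List.getLast?_concat (l := u :: q)) (X.filter (M.Adj u)) (X.filter (M.Adj v))
        (fun z hz => ⟨(hmem z).2 (Finset.mem_filter.1 hz).1, (Finset.mem_filter.1 hz).2⟩)
        (fun z hz => ⟨(hmem z).2 (Finset.mem_filter.1 hz).1, (Finset.mem_filter.1 hz).2.symm⟩)
        (by simp only [d] at hd; omega) (Or.inl (by rw [hlen]; exact hd))
      refine hMham m hm (Finset.eq_of_subset_of_card_le (fun z hz => ?_) ?_)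
      · exact (hmem z).1 (hsub (List.mem_toFinset.1 hz))
      · rw [hX, List.toFinset_card_of_nodup hm.nodup]
        rcases hml with h3 | h3
        · rw [h3.length_eq, hlen]
        · exact le_trans hd h3
  have hbackM : ∀ w ∈ X \ A, s ≤ (X.filter fun z => M.Adj w z ∧ ρ z < ρ w).card := fun w hw =>
    (hback w hw).trans (Finset.card_le_card fun z hz => by
      rw [Finset.mem_filter] at hz ⊢
      exact ⟨hz.1, hGM hz.2.1, hz.2.2⟩)
  have hsubd : ∀ w, (X.filter fun z => M.Adj w z ∧ ρ z < ρ w) ⊆ X.filter (M.Adj w) := fun w z hz => by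
    rw [Finset.mem_filter] at hz ⊢
    exact ⟨hz.1, hz.2.1⟩
  have hds : ∀ w ∈ X \ A, s ≤ d w := fun w hw =>
    (hbackM w hw).trans (Finset.card_le_card (hsubd w))
  have hdA : ∀ a ∈ A, k - s - 1 ≤ d a := by
    intro a ha
    rw [← hA, ← Finset.card_erase_of_mem ha]
    refine Finset.card_le_card fun z hz => ?_
    rw [Finset.mem_erase] at hz
    exact Finset.mem_filter.2 ⟨hAX hz.2, hGM (hclique a ha z hz.2 hz.1.symm)⟩
  have hdA' : ∀ a ∈ A, ∀ w ∈ X \ A, M.Adj a w → k - s ≤ d a := by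
    intro a ha w hw haw
    rw [Finset.mem_sdiff] at hw
    have : insert w (A.erase a) ⊆ X.filter (M.Adj a) := by
      intro z hz
      rw [Finset.mem_insert, Finset.mem_erase] at hz
      rw [Finset.mem_filter]
      rcases hz with rfl | hz
      · exact ⟨hw.1, haw⟩
      · exact ⟨hAX hz.2, hGM (hclique a ha z hz.2 hz.1.symm)⟩
    have := Finset.card_le_card this
    rw [Finset.card_insert_of_notMem (fun h => hw.2 (Finset.mem_of_mem_erase h)),
      Finset.card_erase_of_mem ha, hA] at this
    simp only [d]
    omega
  have hne : ∀ a ∈ A, ∀ w ∈ X \ A, a ≠ w := by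
    rintro a ha w hw rfl
    exact (Finset.mem_sdiff.1 hw).2 ha
  have hjoin : ∀ a ∈ A, (∃ w ∈ X \ A, M.Adj a w) → ∀ w ∈ X \ A, M.Adj a w := by
    rintro a ha ⟨w, hw, haw⟩ w' hw'
    refine hore a (hAX ha) w' (Finset.mem_sdiff.1 hw').1 (hne a ha w' hw') ?_
    have := hdA' a ha w hw haw
    have := hds w' hw'
    omega
  -- A degree above `s` would spread: `w` is joined to all of `A`, then `A` to all of `X \ A`, and
  -- then all degrees outside `A` are at least `k - s` with `2 (k - s) ≥ k`, so `M` is complete on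
  -- `X` and has the forbidden cycle.
  have hdeq : ∀ w ∈ X \ A, d w = s := by
    by_contra hcon
    push Not at hcon
    obtain ⟨w, hw, hdw⟩ := hcon
    have h1 : ∀ a ∈ A, M.Adj a w := by
      intro a ha
      refine hore a (hAX ha) w (Finset.mem_sdiff.1 hw).1 (hne a ha w hw) ?_
      have := hdA a ha
      have := hds w hw
      omega
    have h2 : ∀ a ∈ A, ∀ w' ∈ X \ A, M.Adj a w' := fun a ha => hjoin a ha ⟨w, hw, h1 a ha⟩
    have h3 : ∀ w' ∈ X \ A, k - s ≤ d w' := by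
      intro w' hw'
      rw [← hA]
      exact Finset.card_le_card fun a ha => Finset.mem_filter.2 ⟨hAX ha, (h2 a ha w' hw').symm⟩
    have h4 : ∀ x ∈ X, ∀ y ∈ X, x ≠ y → M.Adj x y := by
      intro x hx y hy hxy
      by_cases hxA : x ∈ A <;> by_cases hyA : y ∈ A
      · exact hGM (hclique x hxA y hyA hxy)
      · exact h2 x hxA y (Finset.mem_sdiff.2 ⟨hy, hyA⟩)
      · exact (h2 y hyA x (Finset.mem_sdiff.2 ⟨hx, hxA⟩)).symm
      · refine hore x hx y hy hxy ?_
        have := h3 x (Finset.mem_sdiff.2 ⟨hx, hxA⟩)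
        have := h3 y (Finset.mem_sdiff.2 ⟨hy, hyA⟩)
        omega
    exact hMham _ (isCycleList_toList (by omega) h4) (Finset.toList_toFinset X)
  have hfil : ∀ w ∈ X \ A, (X.filter fun z => M.Adj w z ∧ ρ z < ρ w) = X.filter (M.Adj w) :=
    fun w hw => Finset.eq_of_subset_of_card_le (hsubd w) ((hdeq w hw).le.trans (hbackM w hw))
  -- All neighbours of `w` in `X` are now earlier than `w`; two adjacent vertices outside `A` would
  -- each precede the other.
  have hinA : ∀ w ∈ X \ A, X.filter (M.Adj w) ⊆ A := by
    intro w hw z hz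
    by_contra hzA
    have hz' := hz
    rw [← hfil w hw, Finset.mem_filter] at hz'
    rw [Finset.mem_filter] at hz
    have hzX : z ∈ X \ A := Finset.mem_sdiff.2 ⟨hz.1, hzA⟩
    have : w ∈ X.filter (M.Adj z) := Finset.mem_filter.2 ⟨(Finset.mem_sdiff.1 hw).1, hz.2.symm⟩
    rw [← hfil z hzX, Finset.mem_filter] at this
    omega
  obtain ⟨w₀, hw₀⟩ : (X \ A).Nonempty := by
    rw [← Finset.card_pos, Finset.card_sdiff_of_subset hAX]
    omega
  have hsame : ∀ w ∈ X \ A, X.filter (M.Adj w) = X.filter (M.Adj w₀) := by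
    intro w hw
    refine (Finset.eq_of_subset_of_card_le (fun a ha => ?_) ?_).symm
    · have haA := hinA w₀ hw₀ ha
      rw [Finset.mem_filter] at ha ⊢
      exact ⟨ha.1, (hjoin a haA ⟨w₀, hw₀, ha.2.symm⟩ w hw).symm⟩
    · exact (hdeq w hw).le.trans (hdeq w₀ hw₀).ge
  refine ⟨X.filter (M.Adj w₀), hinA w₀ hw₀, hdeq w₀ hw₀, fun w hw => ?_⟩
  rw [← hsame w hw]
  refine Finset.eq_of_subset_of_card_le (fun z hz => ?_) ((hdeq w hw).le.trans ?_)
  · rw [Finset.mem_filter] at hz ⊢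
    exact ⟨hz.1, hGM hz.2⟩
  · refine (hback w hw).trans (Finset.card_le_card fun z hz => ?_)
    rw [Finset.mem_filter] at hz ⊢
    exact ⟨hz.1, hz.2.1⟩

/-- The first `k` vertices determine `S`. The first later vertex `w` attached differently is
compared with earlier ones inside another set of `k` vertices containing the clique `A`. If all
earlier neighbours of `w` lie outside `A`, there is no room for `w` in such a set, and a long cycle
through `w` is found instead. -/
theorem Built.exists_eq_shifted {k s : ℕ} (hs : 2 ≤ s) (hsk : 2 * s + 1 ≤ k)
    (hkn : k ≤ Fintype.card V) {ρ : V → ℕ} (hρ : Function.Injective ρ)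
    (hlt : ∀ v, ρ v < Fintype.card V) (h : Built G ρ (k - s) s) (hG : LongCycleFree k G) :
    ∃ S : Finset V, (∀ v ∈ S, ρ v < k - s) ∧ S.card = s ∧ G = shifted ρ (k - s) S := by
  classical
  set A : Finset V := Finset.univ.filter fun v => ρ v < k - s with hAdef
  have hAmem : ∀ v, v ∈ A ↔ ρ v < k - s := fun v => by simp [A]
  have hA : A.card = k - s := card_rank_lt hρ hlt (by omega)
  have hclique : ∀ x ∈ A, ∀ y ∈ A, x ≠ y → G.Adj x y := fun x hx y hy hxy =>
    h.clique x y hxy ((hAmem x).1 hx) ((hAmem y).1 hy)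
  have hbackX : ∀ (X : Finset V) w, back G ρ w ⊆ X →
      X.filter (fun z => G.Adj w z ∧ ρ z < ρ w) = back G ρ w := by
    intro X w hw
    ext z
    rw [Finset.mem_filter, mem_back]
    exact ⟨fun h => h.2, fun h => ⟨hw (mem_back.2 h), h⟩⟩
  -- the vertices of a closed set of `k` vertices are attached in the same way
  have closed : ∀ X : Finset V, A ⊆ X → X.card = k → (∀ w ∈ X \ A, back G ρ w ⊆ X) →
      ∃ S ⊆ A, S.card = s ∧ ∀ w ∈ X \ A, back G ρ w = S := by
    intro X hAX hX hcl
    have hge : ∀ w ∈ X \ A, k - s ≤ ρ w := fun w hw => by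
      have := (Finset.mem_sdiff.1 hw).2
      rw [hAmem] at this
      omega
    obtain ⟨S, hSA, hSs, hS⟩ := exists_common_neighbors hs hsk (ρ := ρ) hAX hX hA hclique
      (fun w hw => by rw [hbackX X w (hcl w hw), h.card_back w (hge w hw)])
      (fun l hl hlX => by
        have h1 := hl.length_lt hG
        have := List.toFinset_card_of_nodup hl.nodup
        rw [hlX, hX] at this
        omega)
    refine ⟨S, hSA, hSs, fun w hw => Finset.eq_of_subset_of_card_le ?_ ?_⟩
    · rw [← hS w hw]
      intro z hz
      exact Finset.mem_filter.2 ⟨hcl w hw hz, (mem_back.1 hz).1⟩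
    · rw [hSs, h.card_back w (hge w hw)]
  obtain ⟨S, hSA, hSs, hS⟩ := closed (Finset.univ.filter fun v => ρ v < k)
    (fun v hv => by
      rw [hAmem] at hv
      simp; omega)
    (card_rank_lt hρ hlt hkn)
    (fun w hw z hz => by
      have := (mem_back.1 hz).2
      simp at hw ⊢
      omega)
  have hSr : ∀ v ∈ S, ρ v < k - s := fun v hv => (hAmem v).1 (hSA hv)
  refine ⟨S, hSr, hSs, h.eq_shifted hρ hSr ?_⟩
  by_contra hall
  push Not at hall
  obtain ⟨w, hw, hmin⟩ := Finset.exists_min_image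
    (Finset.univ.filter fun v => k - s ≤ ρ v ∧ back G ρ v ≠ S) ρ
    (by obtain ⟨v, hv⟩ := hall; exact ⟨v, by simpa using hv⟩)
  simp only [Finset.mem_filter, Finset.mem_univ, true_and] at hw hmin
  have hearlier : ∀ v, k - s ≤ ρ v → ρ v < ρ w → back G ρ v = S := by
    intro v h1 h2
    by_contra hcon
    exact absurd (hmin v ⟨h1, hcon⟩) (by omega)
  have hwk : k ≤ ρ w := by
    by_contra hcon
    refine hw.2 (hS w ?_)
    simp only [Finset.mem_sdiff, Finset.mem_filter, Finset.mem_univ, true_and, hAmem]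
    omega
  have hwA : w ∉ A := by rw [hAmem]; omega
  set J : Finset V := (Finset.univ.filter fun v => ρ v < ρ w) \ A with hJdef
  have hJmem : ∀ v, v ∈ J ↔ ρ v < ρ w ∧ k - s ≤ ρ v := fun v => by simp [J, hAmem]
  have hJ : s ≤ J.card := by
    rw [hJdef, Finset.card_sdiff_of_subset (fun v hv => by
      rw [hAmem] at hv
      simp; omega), card_rank_lt hρ hlt (hlt w).le, hA]
    omega
  have hBJ : back G ρ w \ A ⊆ J := by
    intro v hv
    rw [Finset.mem_sdiff, mem_back, hAmem] at hv
    rw [hJmem]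
    omega
  have hBcard := h.card_back w hw.1
  -- Here `w` and `s - 1` earlier vertices outside `A`, including all earlier neighbours of `w`
  -- there, complete `A` to a closed set of size `k`. As `s ≥ 2`, it contains a vertex already
  -- attached to `S`.
  by_cases hBA : (back G ρ w \ A).card ≤ s - 1
  · obtain ⟨I, hI1, hI2, hI3⟩ := Finset.exists_subsuperset_card_eq hBJ hBA (by omega)
    have hIA : ∀ v ∈ I, v ∉ A := fun v hv => by
      have := (hJmem v).1 (hI2 hv)
      rw [hAmem]; omega
    have hwI : w ∉ I := fun h' => by
      have := (hJmem w).1 (hI2 h')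
      omega
    have hXA : (A ∪ insert w I) \ A = insert w I := by
      refine Finset.union_sdiff_cancel_left (Finset.disjoint_left.2 fun v hv hv' => ?_)
      rcases Finset.mem_insert.1 hv' with rfl | hv'
      · exact hwA hv
      · exact hIA v hv' hv
    obtain ⟨S', hS'A, hS's, hS'⟩ := closed (A ∪ insert w I) Finset.subset_union_left (by
        have h1 := Finset.card_sdiff_add_card_eq_card (s := A) (t := A ∪ insert w I)
          Finset.subset_union_left
        rw [hXA, Finset.card_insert_of_notMem hwI, hI3, hA] at h1
        omega)
      (fun v hv z hz => by
        rw [hXA] at hv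
        rcases Finset.mem_insert.1 hv with rfl | hv
        · by_cases hzA : z ∈ A
          · exact Finset.mem_union_left _ hzA
          · exact Finset.mem_union_right _ (Finset.mem_insert_of_mem
              (hI1 (Finset.mem_sdiff.2 ⟨hz, hzA⟩)))
        · have := (hJmem v).1 (hI2 hv)
          rw [hearlier v this.2 this.1] at hz
          exact Finset.mem_union_left _ (hSA hz))
    rw [hXA] at hS'
    obtain ⟨v, hv⟩ := Finset.card_pos.1 (by omega : 0 < I.card)
    have h1 := hS' v (Finset.mem_insert_of_mem hv)
    have h2 := hS' w (Finset.mem_insert_self _ _)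
    have h3 := (hJmem v).1 (hI2 hv)
    rw [hearlier v h3.2 h3.1] at h1
    exact hw.2 (h2.trans h1.symm)
  · set B := back G ρ w with hB
    have hBA' : B \ A = B := Finset.eq_of_subset_of_card_le Finset.sdiff_subset (by omega)
    rw [hBA'] at hBJ
    have hBdis : ∀ v ∈ B, v ∉ A := fun v hv => by
      rw [← hBA'] at hv
      exact (Finset.mem_sdiff.1 hv).2
    obtain ⟨b₁, hb₁, b₂, hb₂, hb⟩ := Finset.one_lt_card.1 (by omega : 1 < B.card)
    have hXA : (A ∪ B) \ A = B := Finset.union_sdiff_cancel_left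
      (Finset.disjoint_left.2 fun v hv hv' => hBdis v hv' hv)
    have hXcard : (A ∪ B).card = k := by
      have h1 := Finset.card_sdiff_add_card_eq_card (s := A) (t := A ∪ B) Finset.subset_union_left
      rw [hXA, hBcard, hA] at h1
      omega
    obtain ⟨G', hG'⟩ : ∃ G', G' = G ⊔ SimpleGraph.edge b₁ b₂ := ⟨_, rfl⟩
    have hle : G ≤ G' := hG' ▸ le_sup_left
    -- The new edge `b₁b₂` stands for the detour through `w`. If it creates no Hamiltonian cycle on
    -- `A ∪ B`, the closure argument puts all neighbours of `b₁` in this set into `A`, contrary to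
    -- `b₂ ∉ A`; if it does, replacing the edge by the detour gives a cycle of length `k + 1` in
    -- `G`.
    by_cases hham : ∀ l, IsCycleList G' l → l.toFinset ≠ A ∪ B
    · obtain ⟨S', hS'A, -, hS'⟩ := exists_common_neighbors hs hsk (ρ := ρ)
        Finset.subset_union_left hXcard hA (fun x hx y hy hxy => hle (hclique x hx y hy hxy))
        (fun v hv => by
          rw [hXA] at hv
          have h1 := (hJmem v).1 (hBJ hv)
          have h2 := hearlier v h1.2 h1.1
          rw [← hSs, ← h2]
          refine Finset.card_le_card fun z hz => ?_
          have h3 := mem_back.1 hz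
          rw [h2] at hz
          exact Finset.mem_filter.2 ⟨Finset.mem_union_left _ (hSA hz), hle h3.1, h3.2⟩) hham
      rw [hXA] at hS'
      have : b₂ ∈ (A ∪ B).filter (G'.Adj b₁) := by
        rw [Finset.mem_filter, hG', SimpleGraph.sup_adj, SimpleGraph.edge_adj]
        exact ⟨Finset.mem_union_right _ hb₂, Or.inr ⟨Or.inl ⟨rfl, rfl⟩, hb⟩⟩
      rw [hS' b₁ hb₁] at this
      exact hBdis b₂ hb₂ (hS'A this)
    · push Not at hham
      obtain ⟨l, hl, hlX⟩ := hham
      have hlen : l.length = k := by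
        rw [← List.toFinset_card_of_nodup hl.nodup, hlX, hXcard]
      rw [hG'] at hl
      rcases hl.of_sup_edge with h2 | ⟨q, hq, hperm⟩
      · exact absurd (h2.length_lt hG) (by omega)
      · have hwl : w ∉ b₁ :: (q ++ [b₂]) := by
          rw [hperm.mem_iff, ← List.mem_toFinset, hlX, Finset.mem_union, not_or]
          exact ⟨hwA, fun h' => by have := (mem_back.1 h').2; omega⟩
        have hcyc : IsCycleList G (w :: b₁ :: (q ++ [b₂])) := by
          refine ⟨by simp, List.nodup_cons.2 ⟨hwl, hq.nodup⟩,
            List.isChain_cons_cons.2 ⟨(mem_back.1 hb₁).1, hq.chain⟩, fun x hx y hy => ?_⟩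
          have hlast : (b₁ :: (q ++ [b₂])).getLast? = some b₂ := List.getLast?_concat (l := b₁ :: q)
          rw [List.getLast?_cons_cons, hlast] at hx
          simp at hx hy
          subst hx hy
          exact (mem_back.1 hb₂).1.symm
        have := hcyc.length_lt hG
        rw [List.length_cons, hperm.length_eq] at this
        omega

end Uniqueness

/-! ### Identification with the join, and the conclusion -/

section Main

theorem TwoConnected.mono {V : Type u} {G H : SimpleGraph V} (h : TwoConnected G) (hGH : G ≤ H) :
    TwoConnected H :=
  ⟨h.1, h.2.1.mono hGH, fun x => (h.2.2 x).mono fun _ _ hab => hGH hab⟩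

theorem nonempty_iso_graphW {V : Type u} [Fintype V] {ρ : V → ℕ} (hρ : Function.Injective ρ)
    (hlt : ∀ v, ρ v < Fintype.card V) {k s : ℕ} (hsk : 2 * s ≤ k) (hkn : k ≤ Fintype.card V)
    {S : Finset V} (hS : ∀ v ∈ S, ρ v < k - s) (hSs : S.card = s) :
    Nonempty (shifted ρ (k - s) S ≃g graphW (Fintype.card V) k s) := by
  classical
  have hbase := card_rank_lt hρ hlt (by omega : k - s ≤ Fintype.card V)
  have hsub : S ⊆ Finset.univ.filter fun w => ρ w < k - s := fun v hv => by simpa using hS v hv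
  have c1 : Fintype.card {v // v ∈ S} = s := by simpa using hSs
  have c3 : Fintype.card {v // v ∉ S ∧ ρ v < k - s} = k - 2 * s := by
    rw [Fintype.card_subtype]
    have := Finset.card_sdiff_of_subset hsub
    rw [hbase, hSs] at this
    rw [show k - 2 * s = k - s - s by omega, ← this]
    congr 1
    ext v
    simp [and_comm]
  have c2 : Fintype.card {v // k - s ≤ ρ v} = Fintype.card V - k + s := by
    have h1 : Fintype.card {v // k - s ≤ ρ v} = Fintype.card {v // ¬ ρ v < k - s} :=
      Fintype.card_congr (Equiv.subtypeEquivRight fun v => by omega)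
    rw [h1, Fintype.card_subtype_compl, Fintype.card_subtype, hbase]
    omega
  let e1 := (Fintype.equivFinOfCardEq c1).symm
  let e2 := (Fintype.equivFinOfCardEq c2).symm
  let e3 := (Fintype.equivFinOfCardEq c3).symm
  let f : Fin s ⊕ (Fin (Fintype.card V - k + s) ⊕ Fin (k - 2 * s)) → V :=
    Sum.elim (fun i => e1 i) (Sum.elim (fun i => e2 i) fun i => e3 i)
  have p1 : ∀ i, (e1 i : V) ∈ S := fun i => (e1 i).2
  have p1' : ∀ i, ρ (e1 i : V) < k - s := fun i => hS _ (p1 i)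
  have p2 : ∀ i, k - s ≤ ρ (e2 i : V) := fun i => (e2 i).2
  have p2' : ∀ i, (e2 i : V) ∉ S := fun i h => by
    have := hS _ h
    have := p2 i
    omega
  have p3 : ∀ i, (e3 i : V) ∉ S := fun i => (e3 i).2.1
  have p3' : ∀ i, ρ (e3 i : V) < k - s := fun i => (e3 i).2.2
  have hinj : Function.Injective f := by
    rintro (i | i | i) (j | j | j) hij <;> simp only [f, Sum.elim_inl, Sum.elim_inr] at hij
    · rw [e1.injective (Subtype.ext hij)]
    · exact absurd (hij ▸ p1 i) (p2' j)
    · exact absurd (hij ▸ p1 i) (p3 j)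
    · exact absurd (hij ▸ p1 j) (p2' i)
    · rw [e2.injective (Subtype.ext hij)]
    · have h1 := p2 i
      have h2 := p3' j
      rw [hij] at h1; omega
    · exact absurd (hij ▸ p1 j) (p3 i)
    · have h1 := p2 j
      have h2 := p3' i
      rw [hij] at h2; omega
    · rw [e3.injective (Subtype.ext hij)]
  have hbij : Function.Bijective f := by
    rw [Fintype.bijective_iff_injective_and_card]
    refine ⟨hinj, ?_⟩
    simp only [Fintype.card_sum, Fintype.card_fin]
    omega
  refine ⟨SimpleGraph.Iso.symm ⟨Equiv.ofBijective f hbij, ?_⟩⟩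
  intro a b
  have hne : f a ≠ f b ↔ a ≠ b := hinj.ne_iff
  rw [Equiv.ofBijective_apply, Equiv.ofBijective_apply, shifted_adj, hne]
  rcases a with i | i | i <;> rcases b with j | j | j <;>
    simp [f, graphW, join, p1, p1', p2', p3, p3', Nat.not_lt.2 (p2 _)]

end Main

end KelmansExtremal

theorem theorem2p3 (n k : ℕ) (hk : 5 ≤ k) (hkn : k ≤ n)
    (P : KelmansExtremal.GraphParameter) (hP : KelmansExtremal.Feasible P)
    (V : Type*) [Finite V] (hV : Nat.card V = n) (G : SimpleGraph V)
    (hG : KelmansExtremal.TwoConnected G) (hfree : KelmansExtremal.LongCycleFree k G)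
    (hmax : ∀ G' : SimpleGraph V, KelmansExtremal.TwoConnected G' →
      KelmansExtremal.LongCycleFree k G' → P V G' ≤ P V G) :
    ∃ s : ℕ, 2 ≤ s ∧ s ≤ (k - 1) / 2 ∧ Nonempty (G ≃g KelmansExtremal.graphW n k s) := by
  have := Fintype.ofFinite V
  obtain rfl : Fintype.card V = n := by rw [← hV, Nat.card_eq_fintype_card]
  have hsat : KelmansExtremal.Saturated k G := by
    refine KelmansExtremal.saturated_of_sup_edge hfree fun u v huv hadj hcon => ?_
    have h1 := hP.lt_addEdge V G hG.2.1 u v huv hadj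
    have h2 := hmax _ (hG.mono le_sup_left) hcon
    exact absurd h1 h2.not_gt
  obtain ⟨s, A, hs, hst, hA, hdeg⟩ := hsat.exists_degenerate hk hkn hG hfree
  obtain ⟨ρ, hρ, hlt, hback⟩ := KelmansExtremal.exists_rank hdeg
  obtain ⟨G', hGG', hG'⟩ := KelmansExtremal.exists_built (G := G) hρ hlt (r := k - s) (s := s)
    (by omega) (fun v hv => hback v (by omega))
  -- Any `s` of the first `k - s` vertices can serve as target of the compression; the set `T` that
  -- describes `G` in the end is found separately.
  obtain ⟨S, hSsub, hSs⟩ := Finset.exists_subset_card_eq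
    (s := Finset.univ.filter fun v => ρ v < k - s) (n := s)
    (by rw [KelmansExtremal.card_rank_lt hρ hlt (by omega)]; omega)
  have hSr : ∀ v ∈ S, ρ v < k - s := fun v hv => by simpa using hSsub hv
  have hle : P V G' ≤ P V G := (hP.le_shifted hρ (by omega) hSr hSs G' hG').trans
    (hmax _ (KelmansExtremal.shifted_twoConnected (by omega) (by omega))
      (KelmansExtremal.shifted_longCycleFree hρ hlt hs (by omega) hkn hSr hSs))
  -- A proper extension would have strictly larger `P`, against `hle`.
  obtain rfl : G = G' := by
    rcases hGG'.eq_or_lt with h | h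
    · exact h
    · exact absurd (hP.lt_of_lt hG.2.1 h) hle.not_gt
  obtain ⟨T, hT, hTs, rfl⟩ := hG'.exists_eq_shifted hs (by omega) hkn hρ hlt hfree
  exact ⟨s, hs, hst, KelmansExtremal.nonempty_iso_graphW hρ hlt (by omega) hkn hT hTs⟩
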